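/- Consider the following dynamic matching market. Agents of two types, $H$ and $E$, arrive according to independent Poisson processes with rates $\lambda_H>0$ and $\lambda_E>0$. Any agent of type $H$ (respectively $E$) finds the item of any given other agent compatible with probability $p_H\in(0,1]$ (respectively $p_E\in(0,1]$), independently over all ordered pairs of agents. Under the policy BilateralMatch($H$), when a new agent arrives and there are waiting agents with whom she is mutually compatible, she is matched immediately with one of them, chosen uniformly at random among those of type $H$ if there are any, and uniformly at random among those of type $E$ otherwise; the two matched agents leave the market. If there is no such waiting agent, the new agent stays and waits. The numbers $(h,e)$ of waiting agents of types $H$ and $E$ form a continuous-time Markov chain on $\mathbb{N}^2$. Fix $\lambda_E>0$ and $p_E\in(0,1]$. For all $\lambda_H\in(0,\lambda_E)$ and $p_H\in(0,1]$ this chain has a unique stationary distribution, and the average waiting time $w_H(\lambda_H,p_H)$ in steady state of agents of type $H$ (the expected value of departure time minus arrival time) is finite. For every $\lambda_H\in(0,\lambda_E)$ the limiting (rescaled) average waiting time $$L(\lambda_H)=\lim_{p_H\to 0^+} p_H\, w_H(\lambda_H,p_H)$$ exists and is finite, and $\lambda_H\mapsto L(\lambda_H)$ is strictly increasing on the interval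 $(0,\lambda_E)$. -/

import Mathlib

open Set Filter Topology
open scoped ENNReal

namespace DynMarket

/-- The two types of agents: hard-to-match (`H`) and easy-to-match (`E`). -/
inductive AgentType
  | H
  | E
  deriving DecidableEq

instance : Fintype AgentType where
  elems := {AgentType.H, AgentType.E}
  complete := by intro T; cases T <;> simp

/-- The numerical data of a market: Poisson arrival rates of the two types, and the probabilities
with which an agent of each type finds the item of any given other agent compatible. -/
structure Market where
  lamH : ℝ
  lamE : ℝ
  pH : ℝ
  pE : ℝ

noncomputable section

/-- Arrival rate of agents of type `T`. -/
def Market.rate (m : Market) : AgentType → ℝ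
  | .H => m.lamH
  | .E => m.lamE

/-- Probability that an agent of type `T` finds the item of any given other agent compatible. -/
def Market.prob (m : Market) : AgentType → ℝ
  | .H => m.pH
  | .E => m.pE

/-- Rate of the superposition of the two independent Poisson arrival processes. -/
def Market.totalRate (m : Market) : ℝ := ∑ T : AgentType, m.rate T

/-- State of the marketplace: `(h, e)` means that `h` agents of type `H` and `e` agents of type `E`
are waiting. -/
abbrev State := ℕ × ℕ

/-- The agents waiting in state `s`. -/
abbrev Waiting (s : State) := Fin s.1 ⊕ Fin s.2

/-- The type of a waiting agent. -/
def typeOf {s : State} (i : Waiting s) : AgentType :=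
  Sum.elim (fun _ => AgentType.H) (fun _ => AgentType.E) i

/-- One more agent of type `T` is waiting. -/
def addAgent : AgentType → State → State
  | .H, s => (s.1 + 1, s.2)
  | .E, s => (s.1, s.2 + 1)

/-- One agent of type `T` has left. It is only used when such an agent is present. -/
def removeAgent : AgentType → State → State
  | .H, s => (s.1 - 1, s.2)
  | .E, s => (s.1, s.2 - 1)

/-- The edges of the compatibility graph between a newly arrived agent and the waiting agents:
`(ω i).1` says that the newcomer finds the item of `i` compatible (edge from `i` to the newcomer),
`(ω i).2` that `i` finds the item of the newcomer compatible (edge from the newcomer to `i`). -/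
abbrev Edges (s : State) := Waiting s → Bool × Bool

/-- Probability that a Bernoulli variable of parameter `p` takes the value `b`. -/
def bern (p : ℝ) (b : Bool) : ℝ := if b then p else 1 - p

/-- Probability that the edges between a newcomer of type `T` and the waiting agents are `ω`:
all directed edges are formed independently, each with the probability given by the type of the
agent at its head. -/
def edgeProb (m : Market) (T : AgentType) {s : State} (ω : Edges s) : ℝ :=
  ∏ i : Waiting s, bern (m.prob T) (ω i).1 * bern (m.prob (typeOf i)) (ω i).2

/-- The waiting agents that form a cycle of length two with the newcomer. -/
def cyclePartners {s : State} (ω : Edges s) : Finset (Waiting s) :=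
  Finset.univ.filter fun i => ω i = (true, true)

/-- The policy BilateralMatch(`P`): the waiting agents among which the partner of the newcomer is
drawn uniformly at random. These are the cycle partners of type `P` if there are any, and all cycle
partners otherwise; if this set is empty, no exchange takes place. -/
def candidates (P : AgentType) {s : State} (ω : Edges s) : Finset (Waiting s) :=
  if ((cyclePartners ω).filter fun i => typeOf i = P).Nonempty then
    (cyclePartners ω).filter fun i => typeOf i = P
  else cyclePartners ω

/-- Probability that a newcomer of type `T` arriving in state `s` is matched at once with the
waiting agent `i`. -/
def partnerProb (m : Market) (P T : AgentType) (s : State) (i : Waiting s) : ℝ :=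
  ∑ ω : Edges s, edgeProb m T ω *
    (if i ∈ candidates P ω then 1 / ((candidates P ω).card : ℝ) else 0)

/-- Probability that a newcomer of type `T` arriving in state `s` is not matched at once. -/
def stayProb (m : Market) (P T : AgentType) (s : State) : ℝ :=
  ∑ ω : Edges s, edgeProb m T ω * (if candidates P ω = ∅ then 1 else 0)

/-- Probability that an arrival of type `T` changes the state from `s` to `s'`. -/
def arrivalTransition (m : Market) (P T : AgentType) (s s' : State) : ℝ :=
  (if s' = addAgent T s then stayProb m P T s else 0) +
    ∑ i : Waiting s, if s' = removeAgent (typeOf i) s then partnerProb m P T s i else 0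

/-- Transition rates of the continuous-time Markov chain of the numbers of waiting agents under
BilateralMatch(`P`). (Every arrival changes the state, so `Q s s = 0` here; the diagonal of the
generator plays no role below.) -/
def transitionRate (m : Market) (P : AgentType) (s s' : State) : ℝ :=
  ∑ T : AgentType, m.rate T * arrivalTransition m P T s s'

/-- `π` is a steady-state (stationary) distribution of the Markov chain under BilateralMatch(`P`):
it satisfies the global balance equations, flow into `s` equals flow out of `s` for every state. -/
def IsSteadyState (m : Market) (P : AgentType) (π : PMF State) : Prop :=
  ∀ s : State, ∑' s' : State, π s' * ENNReal.ofReal (transitionRate m P s' s) =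
    π s * ∑' s' : State, ENNReal.ofReal (transitionRate m P s s')

/-- A particular agent of type `H` that is waiting together with the agents counted by `o`. Agents
of the same type are exchangeable, so the choice of the label does not matter. -/
def tagged (o : State) : Waiting (addAgent .H o) := Sum.inl (0 : Fin (o.1 + 1))

/-- Probability that a waiting agent of type `H`, in a market where the *other* waiting agents are
counted by `o`, has not been matched by any of the next `n` arrivals. Each arrival is of type `T`
with probability `rate T / totalRate`; the agent keeps waiting if the newcomer stays
unmatched, or is matched with another waiting agent. -/
def stillWaiting (m : Market) (P : AgentType) : ℕ → State → ℝ
  | 0, _ => 1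
  | n + 1, o => ∑ T : AgentType, m.rate T / m.totalRate *
      (stayProb m P T (addAgent .H o) * stillWaiting m P n (addAgent T o) +
        ∑ i ∈ Finset.univ.erase (tagged o),
          partnerProb m P T (addAgent .H o) i * stillWaiting m P n (removeAgent (typeOf i) o))

/-- Probability that the waiting `H` agent of `stillWaiting` is still in the market `t` time units
later: the number of arrivals during that time is Poisson with mean `totalRate * t`. -/
def waitingTail (m : Market) (P : AgentType) (o : State) (t : ℝ) : ℝ≥0∞ :=
  ∑' n : ℕ, ENNReal.ofReal
    (Real.exp (-(m.totalRate * t)) * (m.totalRate * t) ^ n / (n.factorial : ℝ) *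
      stillWaiting m P n o)

/-- Expected remaining time until departure of the waiting `H` agent of `stillWaiting`, as the
integral of the tail of its distribution. -/
def expectedWait (m : Market) (P : AgentType) (o : State) : ℝ≥0∞ :=
  ∫⁻ t in Ioi (0 : ℝ), waitingTail m P o t

/-- Average waiting time (departure time minus arrival time) of agents of type `H` under
BilateralMatch(`P`) when the market is in the steady state `π`: an arriving `H` agent finds the
market in state `s` with probability `π s`; she waits for a time `0` if she is matched upon arrival,
and otherwise joins the agents counted by `s`. -/
def averageWaitH (m : Market) (P : AgentType) (π : PMF State) : ℝ≥0∞ :=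
  ∑' s : State, π s * (ENNReal.ofReal (stayProb m P .H s) * expectedWait m P s)

end

end DynMarket

/-!
The squared number of waiting agents has negative drift outside a finite set of states, so the chain
has a stationary distribution with finite mean. It is unique because the empty market is reached
from every state.

Little's law `lamH * w_H = E[h]` comes from following one waiting agent of type `H`: her expected
remaining waiting time is the Green function of the arrival chain killed when she is matched, and
the stationary distribution weighted by the number of `H` agents solves the corresponding balance
equation.

Let `u = 1 - pE * pH`. For small `pH` an arriving `H` agent is rarely matched at once, so the drift
of `h` is close to `lamH - lamE * (1 - u ^ h)`, which vanishes at `h = c` with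
`u ^ c = 1 - lamH / lamE`. Applying the generator to `(h - c) ^ 2`, with the error term controlled
by applying it to `e ^ 2`, bounds the mean of `(h - c) * (1 - lamH / lamE - u ^ h)` uniformly in
`pH`. Hence `-log u * h` concentrates at `-log (1 - lamH / lamE)` as `pH → 0`, and the
limit is `-log (1 - lamH / lamE) / (pE * lamH)`, which increases in `lamH` by concavity of `log`.
-/

namespace DynMarket

noncomputable section

section DiscreteChain

variable {S : Type*} {K : S → PMF S}

/-- Integral of a nonnegative, possibly infinite function against a discrete measure with weights
`μ`; for a probability distribution, its expectation. -/
def mean (μ : S → ℝ≥0∞) (f : S → ℝ≥0∞) : ℝ≥0∞ := ∑' s, μ s * f s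

lemma mean_mono (μ : S → ℝ≥0∞) {f g : S → ℝ≥0∞} (h : ∀ s, f s ≤ g s) : mean μ f ≤ mean μ g :=
  ENNReal.tsum_le_tsum fun s => by gcongr; exact h s

lemma mean_add (μ f g : S → ℝ≥0∞) : mean μ (fun s => f s + g s) = mean μ f + mean μ g := by
  simp only [mean, mul_add, ENNReal.tsum_add]

lemma mean_const_mul (μ : S → ℝ≥0∞) (c : ℝ≥0∞) (f : S → ℝ≥0∞) :
    mean μ (fun s => c * f s) = c * mean μ f := by
  simp only [mean, mul_left_comm, ENNReal.tsum_mul_left]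

lemma mean_const (π : PMF S) (c : ℝ≥0∞) : mean π (fun _ => c) = c := by
  rw [mean, ENNReal.tsum_mul_right, π.tsum_coe, one_mul]

lemma mean_pure (o : S) (f : S → ℝ≥0∞) : mean (PMF.pure o) f = f o := by
  rw [mean, tsum_eq_single o fun s hs => by simp [hs]]
  simp

lemma mean_bind {ι : Type*} (π : PMF ι) (κ : ι → PMF S) (f : S → ℝ≥0∞) :
    mean (π.bind κ) f = mean π fun i => mean (κ i) f := by
  simp only [mean, PMF.bind_apply, ← ENNReal.tsum_mul_left, ← ENNReal.tsum_mul_right]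
  rw [ENNReal.tsum_comm]
  simp only [mul_assoc]

lemma mean_ofReal_le_of_le_affine {π : PMF S} {f g : S → ℝ} {c k B : ℝ} (hc : 0 ≤ c) (hk : 0 ≤ k)
    (hB : 0 ≤ B) (hf : ∀ s, f s ≤ c + k * g s)
    (hg : mean π (fun s => .ofReal (g s)) ≤ .ofReal B) :
    mean π (fun s => .ofReal (f s)) ≤ .ofReal (c + k * B) := by
  calc mean π (fun s => .ofReal (f s))
      ≤ mean π (fun s => .ofReal c + .ofReal k * .ofReal (g s)) := mean_mono π fun s => by
        rw [← ENNReal.ofReal_mul hk]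
        exact (ENNReal.ofReal_le_ofReal (hf s)).trans ENNReal.ofReal_add_le
    _ = .ofReal c + .ofReal k * mean π (fun s => .ofReal (g s)) := by
        rw [mean_add, mean_const, mean_const_mul]
    _ ≤ .ofReal c + .ofReal k * .ofReal B := by gcongr
    _ = .ofReal (c + k * B) := by
        rw [← ENNReal.ofReal_mul hk, ← ENNReal.ofReal_add hc (mul_nonneg hk hB)]

lemma abs_toReal_mean_sub_le {π : PMF S} {f : S → ℝ} {x B : ℝ} (hx : 0 ≤ x) (hB : 0 ≤ B)
    (h : mean π (fun s => .ofReal |f s - x|) ≤ .ofReal B) :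
    |(mean π fun s => .ofReal (f s)).toReal - x| ≤ B := by
  have hupper : mean π (fun s => .ofReal (f s)) ≤ .ofReal (x + 1 * B) :=
    mean_ofReal_le_of_le_affine hx zero_le_one hB (fun s => by linarith [le_abs_self (f s - x)]) h
  have hlower : .ofReal x ≤ mean π (fun s => .ofReal (f s)) + .ofReal B := by
    calc ENNReal.ofReal x = mean π (fun _ => .ofReal x) := (mean_const π _).symm
      _ ≤ mean π (fun s => .ofReal (f s) + .ofReal |f s - x|) := mean_mono π fun s =>
          (ENNReal.ofReal_le_ofReal (by linarith [neg_abs_le (f s - x)])).trans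
            ENNReal.ofReal_add_le
      _ ≤ _ := by rw [mean_add]; gcongr
  have hfin := ne_top_of_le_ne_top ENNReal.ofReal_ne_top hupper
  rw [← ENNReal.ofReal_toReal hfin] at hupper hlower
  rw [← ENNReal.ofReal_add ENNReal.toReal_nonneg hB,
    ENNReal.ofReal_le_ofReal_iff (add_nonneg ENNReal.toReal_nonneg hB)] at hlower
  rw [ENNReal.ofReal_le_ofReal_iff (by linarith)] at hupper
  exact abs_le.2 ⟨by linarith, by linarith⟩

/-- The function `F` may have infinite mean, which is why it is truncated in the proof. -/
lemma mean_le_mean_of_drift {π : PMF S} (hπ : π.bind K = π) {F f g : S → ℝ≥0∞}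
    (hF : ∀ s, F s ≠ ⊤) (h : ∀ s, mean (K s) F + g s ≤ F s + f s) : mean π g ≤ mean π f := by
  classical
  have htrunc (n : ℕ) : mean π (fun s => if F s ≤ n then g s else 0) ≤ mean π f := by
    set G : S → ℝ≥0∞ := fun s => min (F s) n
    have hdrift (s : S) : mean (K s) G + (if F s ≤ n then g s else 0) ≤ G s + f s := by
      split_ifs with hs
      · calc mean (K s) G + g s ≤ mean (K s) F + g s := by
              gcongr; exact mean_mono _ fun _ => min_le_left _ _
          _ ≤ G s + f s := by rw [show G s = F s from min_eq_left hs]; exact h s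
      · calc mean (K s) G + 0 ≤ mean (K s) fun _ => (n : ℝ≥0∞) := by
              rw [add_zero]; exact mean_mono _ fun _ => min_le_right _ _
          _ = G s := by rw [mean_const]; exact (min_eq_right (not_le.1 hs).le).symm
          _ ≤ G s + f s := le_self_add
    have hG : mean π G ≠ ⊤ := ne_top_of_le_ne_top (ENNReal.natCast_ne_top n)
      ((mean_mono π fun _ => min_le_right _ _).trans_eq (mean_const π n))
    have hsum := mean_mono π hdrift
    rw [mean_add, mean_add, ← mean_bind, hπ] at hsum
    exact (ENNReal.add_le_add_iff_left hG).1 hsum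
  refine ENNReal.summable.tsum_le_of_sum_le fun A => ?_
  obtain ⟨n, hn⟩ := ENNReal.exists_nat_gt (ENNReal.sum_ne_top.2 fun s (_ : s ∈ A) => hF s)
  calc ∑ s ∈ A, π s * g s = ∑ s ∈ A, π s * (if F s ≤ n then g s else 0) :=
        Finset.sum_congr rfl fun s hs => by
          rw [if_pos ((Finset.single_le_sum (fun _ _ => zero_le) hs).trans hn.le)]
    _ ≤ mean π (fun s => if F s ≤ n then g s else 0) := ENNReal.sum_le_tsum A
    _ ≤ mean π f := htrunc n

lemma eq_of_le_of_tsum_eq {f g : S → ℝ≥0∞} (h : ∀ s, f s ≤ g s) (hs : ∑' s, f s = ∑' s, g s)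
    (hf : ∑' s, f s ≠ ⊤) : f = g := by
  by_contra hne
  obtain ⟨s, hs'⟩ := Function.ne_iff.1 hne
  exact (ENNReal.tsum_lt_tsum hf h ((h s).lt_of_ne hs')).ne hs

/-- Summing over all states turns a pointwise inequality of measures into an equality. -/
lemma tsum_mul_eq_of_le {μ : S → ℝ≥0∞} (hμ : ∑' s, μ s ≠ ⊤)
    (h : ∀ s, ∑' a, μ a * K a s ≤ μ s) (s : S) : ∑' a, μ a * K a s = μ s := by
  have hmass : ∑' s, ∑' a, μ a * K a s = ∑' s, μ s := by
    rw [ENNReal.tsum_comm]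
    simp_rw [ENNReal.tsum_mul_left, PMF.tsum_coe, mul_one]
  exact congr_fun (eq_of_le_of_tsum_eq h hmass (hmass ▸ hμ)) s

lemma eq_zero_of_reaches {μ : S → ℝ≥0∞} (hμ : ∀ s, ∑' a, μ a * K a s = μ s) {s t : S}
    (hst : Relation.ReflTransGen (fun a b => K a b ≠ 0) s t) (ht : μ t = 0) : μ s = 0 := by
  induction hst using Relation.ReflTransGen.head_induction_on with
  | refl => exact ht
  | @head a c hab _ hc =>
    have hsum := hμ c
    rw [hc, ENNReal.tsum_eq_zero] at hsum
    exact (mul_eq_zero.1 (hsum a)).resolve_right hab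

/-- The part of one stationary distribution exceeding another one is an invariant measure which
vanishes at `o` for a suitable order of the two, hence everywhere. -/
lemma stationary_unique {o : S}
    (ho : ∀ s, Relation.ReflTransGen (fun a b => K a b ≠ 0) s o) {π₁ π₂ : PMF S}
    (h₁ : π₁.bind K = π₁) (h₂ : π₂.bind K = π₂) : π₁ = π₂ := by
  wlog hle : π₁ o ≤ π₂ o generalizing π₁ π₂
  · exact (this h₂ h₁ (le_of_not_ge hle)).symm
  have hinv₁ (s : S) : ∑' a, π₁ a * K a s = π₁ s := by rw [← PMF.bind_apply, h₁]
  have hinv₂ (s : S) : ∑' a, π₂ a * K a s = π₂ s := by rw [← PMF.bind_apply, h₂]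
  have hmin_inv := tsum_mul_eq_of_le (K := K) (μ := fun s => min (π₁ s) (π₂ s))
    (ne_top_of_le_ne_top π₁.tsum_coe_ne_top (ENNReal.tsum_le_tsum fun _ => min_le_left _ _))
    fun s => le_min
      ((ENNReal.tsum_le_tsum fun _ => by gcongr; exact min_le_left _ _).trans_eq (hinv₁ s))
      ((ENNReal.tsum_le_tsum fun _ => by gcongr; exact min_le_right _ _).trans_eq (hinv₂ s))
  have hsub_inv (s : S) :
      ∑' a, (π₁ a - min (π₁ a) (π₂ a)) * K a s = π₁ s - min (π₁ s) (π₂ s) := by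
    refine ENNReal.eq_sub_of_add_eq (ne_top_of_le_ne_top (π₁.apply_ne_top s) (min_le_left _ _)) ?_
    calc _ = ∑' a, (π₁ a - min (π₁ a) (π₂ a)) * K a s + ∑' a, min (π₁ a) (π₂ a) * K a s := by
          rw [hmin_inv s]
      _ = ∑' a, π₁ a * K a s := by
          rw [← ENNReal.tsum_add]
          exact tsum_congr fun a => by rw [← add_mul, tsub_add_cancel_of_le (min_le_left _ _)]
      _ = π₁ s := hinv₁ s
  have hle' (s : S) : π₁ s ≤ π₂ s :=
    (tsub_eq_zero_iff_le.1 (eq_zero_of_reaches hsub_inv (ho s) (by simp [hle]))).trans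
      (min_le_right _ _)
  exact DFunLike.coe_injective
    (eq_of_le_of_tsum_eq hle' (π₁.tsum_coe.trans π₂.tsum_coe.symm) π₁.tsum_coe_ne_top)

lemma tight_of_mean_le {ι : Type*} {μ : ι → PMF S} {g : S → ℝ≥0∞} {C : ℝ≥0∞} (hC : C ≠ ⊤)
    (hg : ∀ B ≠ ⊤, {s | g s ≤ B}.Finite) (hμ : ∀ i, mean (μ i) g ≤ C) {ε : ℝ≥0∞} (hε : ε ≠ 0)
    (hε' : ε ≠ ⊤) : ∃ A : Finset S, ∀ i, 1 ≤ ∑ s ∈ A, μ i s + ε := by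
  classical
  have hfin := hg (C / ε) (ENNReal.div_ne_top hC hε)
  refine ⟨hfin.toFinset, fun i => ?_⟩
  have hmarkov (s : S) : 1 ≤ (if s ∈ hfin.toFinset then 1 else 0) + (C / ε)⁻¹ * g s := by
    split_ifs with hs
    · exact le_self_add
    · rw [zero_add, mul_comm, ← div_eq_mul_inv]
      have hs' : C / ε < g s := not_le.1 fun h => hs (hfin.mem_toFinset.2 h)
      exact (ENNReal.le_div_iff_mul_le (.inr hs'.ne_bot) (.inl hs'.ne_top)).2
        (by rw [one_mul]; exact hs'.le)
  calc (1 : ℝ≥0∞) = mean (μ i) fun _ => 1 := (mean_const _ 1).symm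
    _ ≤ mean (μ i) (fun s => if s ∈ hfin.toFinset then 1 else 0) + (C / ε)⁻¹ * mean (μ i) g := by
        rw [← mean_const_mul, ← mean_add]; exact mean_mono _ hmarkov
    _ ≤ ∑ s ∈ hfin.toFinset, μ i s + ε := by
        gcongr
        · rw [mean, tsum_eq_sum fun s hs => by rw [if_neg hs, mul_zero]]
          exact Finset.sum_le_sum fun s _ => mul_le_of_le_one_right zero_le (by split_ifs; simp)
        · rw [mul_comm, ← div_eq_mul_inv]
          refine ENNReal.div_le_of_le_mul ((hμ i).trans_eq ?_)
          rw [ENNReal.mul_div_cancel hε hε']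

lemma exists_stationary_of_tight {μ : ℕ → PMF S} {ε : ℕ → ℝ≥0∞} (hε : Tendsto ε atTop (𝓝 0))
    (hinv : ∀ n s, (μ n).bind K s ≤ μ n s + ε n)
    (htight : ∀ δ : ℝ≥0∞, δ ≠ 0 → δ ≠ ⊤ → ∃ A : Finset S, ∀ n, 1 ≤ ∑ s ∈ A, μ n s + δ) :
    ∃ π : PMF S, π.bind K = π := by
  choose ρ hρ using fun s =>
    (⟨_, ((hyperfilter ℕ).map fun n => μ n s).le_nhds_lim⟩ :
      ∃ x, Tendsto (fun n => μ n s) (hyperfilter ℕ) (𝓝 x))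
  have hsum (A : Finset S) (f : S → ℝ≥0∞) (hf : ∀ s, f s ≠ ⊤) :
      Tendsto (fun n => ∑ s ∈ A, μ n s * f s) (hyperfilter ℕ) (𝓝 (∑ s ∈ A, ρ s * f s)) :=
    tendsto_finsetSum A fun s _ => ENNReal.Tendsto.mul_const (hρ s) (.inr (hf s))
  have hmass : ∑' s, ρ s = 1 := by
    have hsum' (A : Finset S) :
        Tendsto (fun n => ∑ s ∈ A, μ n s) (hyperfilter ℕ) (𝓝 (∑ s ∈ A, ρ s)) := by
      simpa using hsum A 1 (by simp)
    refine le_antisymm (ENNReal.summable.tsum_le_of_sum_le fun A => ?_)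
      (ENNReal.le_of_forall_pos_le_add fun δ hδ _ => ?_)
    · exact le_of_tendsto (hsum' A)
        (.of_forall fun n => (ENNReal.sum_le_tsum A).trans_eq (μ n).tsum_coe)
    · obtain ⟨A, hA⟩ := htight δ (by simpa using hδ.ne') ENNReal.coe_ne_top
      exact (ge_of_tendsto ((hsum' A).add_const _) (.of_forall hA)).trans
        (by gcongr; exact ENNReal.sum_le_tsum A)
  have hle (s : S) : ∑' a, ρ a * K a s ≤ ρ s := by
    refine ENNReal.summable.tsum_le_of_sum_le fun A => ?_
    have hlim : Tendsto (fun n => μ n s + ε n) (hyperfilter ℕ) (𝓝 (ρ s + 0)) :=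
      (hρ s).add (hε.mono_left Nat.hyperfilter_le_atTop)
    rw [add_zero] at hlim
    refine le_of_tendsto_of_tendsto (hsum A _ fun a => (K a).apply_ne_top s) hlim
      (.of_forall fun n => ?_)
    exact (ENNReal.sum_le_tsum A).trans ((PMF.bind_apply _ _ _).symm.trans_le (hinv n s))
  refine ⟨⟨ρ, hmass ▸ ENNReal.summable.hasSum⟩, PMF.ext fun s => ?_⟩
  exact tsum_mul_eq_of_le (hmass ▸ ENNReal.one_ne_top) hle s

/-- The law after `n` steps of the Markov chain with kernel `K` started at `o`. -/
def law (K : S → PMF S) (o : S) : ℕ → PMF S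
  | 0 => PMF.pure o
  | n + 1 => (law K o n).bind K

/-- The law of the chain started at `o` at a uniformly chosen time in `{0, …, n}`, which is nearly
stationary for large `n`. -/
def occupation (K : S → PMF S) (o : S) (n : ℕ) : PMF S :=
  (PMF.uniformOfFintype (Fin (n + 1))).bind fun i => law K o i

lemma mean_occupation (K : S → PMF S) (o : S) (n : ℕ) (f : S → ℝ≥0∞) :
    mean (occupation K o n) f
      = ((n + 1 : ℕ) : ℝ≥0∞)⁻¹ * ∑ i ∈ Finset.range (n + 1), mean (law K o i) f := by
  rw [occupation, mean_bind, mean, tsum_fintype, ← Fin.sum_univ_eq_sum_range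
    (fun i => mean (law K o i) f), Finset.mul_sum]
  simp

lemma occupation_apply (K : S → PMF S) (o : S) (n : ℕ) (s : S) :
    occupation K o n s
      = ((n + 1 : ℕ) : ℝ≥0∞)⁻¹ * ∑ i ∈ Finset.range (n + 1), law K o i s := by
  classical
  simpa [mean, tsum_ite_eq] using mean_occupation K o n fun a => if a = s then 1 else 0

lemma occupation_bind_le (K : S → PMF S) (o : S) (n : ℕ) (s : S) :
    (occupation K o n).bind K s ≤ occupation K o n s + ((n + 1 : ℕ) : ℝ≥0∞)⁻¹ := by
  calc (occupation K o n).bind K s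
      = ((n + 1 : ℕ) : ℝ≥0∞)⁻¹ * ∑ i ∈ Finset.range (n + 1), law K o (i + 1) s := by
        rw [PMF.bind_apply]; exact mean_occupation K o n fun a => K a s
    _ ≤ ((n + 1 : ℕ) : ℝ≥0∞)⁻¹ * (∑ i ∈ Finset.range (n + 1), law K o i s + 1) := by
        gcongr
        rw [Finset.sum_range_succ]
        gcongr
        · rw [Finset.sum_range_succ']; exact le_self_add
        · exact PMF.coe_le_one _ _
    _ = _ := by rw [mul_add, mul_one, occupation_apply]

lemma mean_law_add_sum_le {F g : S → ℝ≥0∞} {c : ℝ≥0∞}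
    (h : ∀ s, mean (K s) F + g s ≤ F s + c) (o : S) (n : ℕ) :
    mean (law K o n) F + ∑ i ∈ Finset.range n, mean (law K o i) g ≤ F o + n * c := by
  induction n with
  | zero => simp [law, mean_pure]
  | succ n ih =>
    have hstep := mean_mono (law K o n) h
    rw [mean_add, mean_add, mean_const, ← mean_bind] at hstep
    calc mean (law K o (n + 1)) F + ∑ i ∈ Finset.range (n + 1), mean (law K o i) g
        = mean ((law K o n).bind K) F + mean (law K o n) g
            + ∑ i ∈ Finset.range n, mean (law K o i) g := by
          rw [Finset.sum_range_succ, law]; ring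
      _ ≤ mean (law K o n) F + c + ∑ i ∈ Finset.range n, mean (law K o i) g := by gcongr
      _ ≤ F o + n * c + c := by rw [add_right_comm]; gcongr
      _ = F o + (n + 1 : ℕ) * c := by push_cast; ring

lemma mean_occupation_le {F g : S → ℝ≥0∞} {c : ℝ≥0∞}
    (h : ∀ s, mean (K s) F + g s ≤ F s + c) (o : S) (n : ℕ) :
    mean (occupation K o n) g ≤ F o + c := by
  rw [mean_occupation, mul_comm, ← div_eq_mul_inv]
  refine ENNReal.div_le_of_le_mul ((le_add_self.trans (mean_law_add_sum_le h o (n + 1))).trans ?_)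
  rw [add_mul, mul_comm c]
  gcongr
  exact le_mul_of_one_le_right zero_le (by simp)

lemma exists_stationary_of_drift {F g : S → ℝ≥0∞} {c : ℝ≥0∞} {o : S} (hFo : F o ≠ ⊤) (hc : c ≠ ⊤)
    (hg : ∀ B ≠ ⊤, {s | g s ≤ B}.Finite) (h : ∀ s, mean (K s) F + g s ≤ F s + c) :
    ∃ π : PMF S, π.bind K = π :=
  exists_stationary_of_tight
    ((ENNReal.tendsto_inv_nat_nhds_zero).comp (tendsto_add_atTop_nat 1)) (occupation_bind_le K o)
    fun _ => tight_of_mean_le (ENNReal.add_ne_top.2 ⟨hFo, hc⟩) hg (mean_occupation_le h o)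

section Killed

variable {μ ν : S → ℝ≥0∞} {R : Module.End ℝ (S → ℝ)}

lemma pow_apply_nonneg (hR : ∀ F, 0 ≤ F → 0 ≤ R F) {F : S → ℝ} (hF : 0 ≤ F) (n : ℕ) :
    0 ≤ (R ^ n) F := by
  induction n with
  | zero => exact hF
  | succ n ih => rw [pow_succ']; exact hR _ ih

variable (hR : ∀ F, 0 ≤ F → 0 ≤ R F)
  (hbalance : ∀ F : S → ℝ, 0 ≤ F → mean μ (fun s => .ofReal (F s))
    = mean μ (fun s => .ofReal (R F s)) + mean ν fun s => .ofReal (F s))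
include hR hbalance

lemma mean_pow_apply_eq {F : S → ℝ} (hF : 0 ≤ F) (n : ℕ) :
    mean μ (fun s => .ofReal ((R ^ n) F s))
      = mean μ (fun s => .ofReal ((R ^ (n + 1)) F s)) + mean ν fun s => .ofReal ((R ^ n) F s) := by
  rw [pow_succ']
  exact hbalance _ (pow_apply_nonneg hR hF n)

lemma mean_eq_mean_pow_add_sum {F : S → ℝ} (hF : 0 ≤ F) (n : ℕ) :
    mean μ (fun s => .ofReal (F s)) = mean μ (fun s => .ofReal ((R ^ n) F s))
      + ∑ i ∈ Finset.range n, mean ν fun s => .ofReal ((R ^ i) F s) := by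
  induction n with
  | zero => simp
  | succ n ih => rw [ih, mean_pow_apply_eq hR hbalance hF n, Finset.sum_range_succ,
      add_assoc, add_comm (mean ν _)]

variable (hlt : ∀ s, R 1 s < 1) (hμ : ∑' s, μ s ≠ ⊤)
include hlt hμ

lemma mean_pow_one_sub (n : ℕ) :
    mean μ (fun s => .ofReal ((R ^ n) (1 - R 1) s)) = mean ν fun s => .ofReal ((R ^ n) 1 s) := by
  have hk : 0 ≤ 1 - R 1 := fun s => sub_nonneg.2 (hlt s).le
  have hfin : mean μ (fun s => .ofReal ((R ^ (n + 1)) 1 s)) ≠ ⊤ := by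
    refine ne_top_of_le_ne_top hμ ?_
    refine (le_self_add.trans_eq
      (mean_eq_mean_pow_add_sum hR hbalance (F := 1) zero_le_one (n + 1)).symm).trans ?_
    simp [mean]
  rw [← ENNReal.add_right_inj hfin, ← mean_pow_apply_eq hR hbalance zero_le_one, ← mean_add]
  congr 1 with s
  rw [← ENNReal.ofReal_add (pow_apply_nonneg hR zero_le_one _ s) (pow_apply_nonneg hR hk n s),
    map_sub, pow_succ]
  simp

/-- On a finite set carrying most of the mass, killing has a probability bounded below. -/
lemma exists_mean_pow_one_le {ε : ℝ≥0∞} (hε : 0 < ε) : ∃ C : ℝ, ∀ n,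
    mean μ (fun s => .ofReal ((R ^ n) 1 s))
      ≤ ε + .ofReal C * mean ν fun s => .ofReal ((R ^ n) 1 s) := by
  classical
  obtain ⟨A, hA⟩ := ((ENNReal.tendsto_tsum_compl_atTop_zero hμ).eventually_lt_const hε).exists
  set k : S → ℝ := 1 - R 1
  have hk (s : S) : 0 < k s := sub_pos.2 (hlt s)
  set G : S → ℝ := (A : Set S)ᶜ.indicator 1
  have hG : 0 ≤ G := fun s => indicator_nonneg (fun _ _ => zero_le_one) s
  set C : ℝ := ∑ s ∈ A, (k s)⁻¹
  have hC : 0 ≤ C := Finset.sum_nonneg fun s _ => (inv_pos.2 (hk s)).le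
  have hle : 0 ≤ G + C • k - 1 := fun s => sub_nonneg.2 <| by
    by_cases hs : s ∈ A
    · have hs' : (k s)⁻¹ ≤ C :=
        Finset.single_le_sum (f := fun s => (k s)⁻¹) (fun s _ => (inv_pos.2 (hk s)).le) hs
      simpa [G, hs] using (inv_le_iff_one_le_mul₀ (hk s)).1 hs'
    · simpa [G, hs] using mul_nonneg hC (hk s).le
  have hmeanG (n : ℕ) : mean μ (fun s => .ofReal ((R ^ n) G s)) ≤ ε := by
    refine (le_self_add.trans_eq (mean_eq_mean_pow_add_sum hR hbalance hG n).symm).trans ?_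
    refine le_of_eq_of_le ?_ hA.le
    refine Eq.trans (tsum_congr fun s => ?_) (tsum_subtype {s | s ∉ A} μ).symm
    by_cases hs : s ∈ A <;> simp [G, hs]
  refine ⟨C, fun n => ?_⟩
  have hpow (s : S) : (R ^ n) 1 s ≤ (R ^ n) G s + C * (R ^ n) k s := by
    have := pow_apply_nonneg hR hle n s
    simpa [map_sub, map_add] using this
  rw [← mean_pow_one_sub hR hbalance hlt hμ, ← mean_const_mul]
  refine (mean_mono μ fun s => ?_).trans ((mean_add μ _ _).trans_le (by gcongr; exact hmeanG n))
  rw [← ENNReal.ofReal_mul hC]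
  exact (ENNReal.ofReal_le_ofReal (hpow s)).trans ENNReal.ofReal_add_le

lemma tsum_eq_tsum_mean_pow_one :
    ∑' s, μ s = ∑' n, mean ν fun s => .ofReal ((R ^ n) 1 s) := by
  set b : ℕ → ℝ≥0∞ := fun n => mean ν fun s => .ofReal ((R ^ n) 1 s)
  have hmass : ∑' s, μ s = mean μ fun s => .ofReal ((1 : S → ℝ) s) := by simp [mean]
  have hsplit := mean_eq_mean_pow_add_sum hR hbalance (F := 1) zero_le_one
  have hb : ∑' n, b n ≠ ⊤ := ne_top_of_le_ne_top hμ <|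
    ENNReal.tsum_le_of_sum_range_le fun n => hmass ▸ (hsplit n) ▸ le_add_self
  have hdecay : Tendsto (fun n => mean μ fun s => .ofReal ((R ^ n) 1 s)) atTop (𝓝 0) := by
    refine ENNReal.tendsto_nhds_zero.2 fun ε hε => ?_
    obtain ⟨C, hC⟩ := exists_mean_pow_one_le hR hbalance hlt hμ (ENNReal.half_pos hε.ne')
    have hCb : Tendsto (fun n => ENNReal.ofReal C * b n) atTop (𝓝 0) := by
      simpa using ENNReal.Tendsto.const_mul (ENNReal.tendsto_atTop_zero_of_tsum_ne_top hb)
        (.inr ENNReal.ofReal_ne_top)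
    filter_upwards [ENNReal.tendsto_nhds_zero.1 hCb _ (ENNReal.half_pos hε.ne')] with n hn
    exact (hC n).trans ((add_le_add_right hn _).trans_eq (ENNReal.add_halves ε))
  have hlim := hdecay.add (ENNReal.tendsto_nat_tsum b)
  rw [zero_add] at hlim
  exact hmass.trans (tendsto_nhds_unique (tendsto_const_nhds.congr hsplit) hlim)

end Killed

end DiscreteChain

section Policy

variable {m : Market} {P T : AgentType} {s : State}

/-- Probability that a newcomer of type `T` and a given waiting agent of type `S` are not mutually
compatible. -/
def Market.miss (m : Market) (T S : AgentType) : ℝ := 1 - m.prob T * m.prob S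

lemma sum_edgeProb_avoid (m : Market) (T : AgentType) (s : State) (A : Waiting s → Prop)
    [DecidablePred A] :
    ∑ ω : Edges s, edgeProb m T ω * (if ∀ i, A i → ω i ≠ (true, true) then 1 else 0)
      = ∏ i with A i, m.miss T (typeOf i) := by
  have hfactor (i : Waiting s) : (if A i then m.miss T (typeOf i) else 1)
      = ∑ b : Bool × Bool, bern (m.prob T) b.1 * bern (m.prob (typeOf i)) b.2
          * (if A i → b ≠ (true, true) then 1 else 0) := by
    rw [Fintype.sum_prod_type]
    by_cases h : A i <;> simp [h, bern, Market.miss] <;> ring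
  rw [Finset.prod_filter, Finset.prod_congr rfl fun i _ => hfactor i, Finset.prod_univ_sum,
    Fintype.piFinset_univ]
  refine Finset.sum_congr rfl fun ω _ => ?_
  rw [Finset.prod_mul_distrib, edgeProb]
  congr 1
  split_ifs with h
  · exact (Finset.prod_eq_one fun i _ => if_pos (h i)).symm
  · push Not at h
    obtain ⟨i, hi, hω⟩ := h
    exact (Finset.prod_eq_zero (Finset.mem_univ i) (by simp [hi, hω])).symm

lemma sum_edgeProb (m : Market) (T : AgentType) (s : State) :
    ∑ ω : Edges s, edgeProb m T ω = 1 := by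
  simpa using sum_edgeProb_avoid m T s fun _ => False

lemma mem_candidates {ω : Edges s} {j : Waiting s} :
    j ∈ candidates P ω ↔ ω j = (true, true) ∧
      (typeOf j = P ∨ ∀ k, typeOf k = P → ω k ≠ (true, true)) := by
  unfold candidates
  split_ifs with h <;>
    simp only [cyclePartners, Finset.Nonempty, Finset.mem_filter, Finset.mem_univ, true_and] at h ⊢
  · obtain ⟨k, hk, hkP⟩ := h
    exact and_congr_right fun _ => ⟨.inl, fun h => h.resolve_right fun h' => h' k hkP hk⟩
  · exact ⟨fun hj => ⟨hj, .inr fun k hkP hk => h ⟨k, hk, hkP⟩⟩, And.left⟩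

lemma candidates_eq_empty_iff {ω : Edges s} :
    candidates P ω = ∅ ↔ ∀ i, ω i ≠ (true, true) := by
  rw [Finset.eq_empty_iff_forall_notMem]
  simp only [mem_candidates, not_and_or, not_or, ne_eq]
  refine ⟨fun h => ?_, fun h i => .inl (h i)⟩
  have hP (k : Waiting s) (hk : typeOf k = P) : ω k ≠ (true, true) :=
    (h k).resolve_right fun h' => h'.1 hk
  exact fun i => (h i).resolve_right fun h' => h'.2 hP

lemma stayProb_eq (m : Market) (P T : AgentType) (s : State) :
    stayProb m P T s = m.miss T .H ^ s.1 * m.miss T .E ^ s.2 := by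
  simpa [stayProb, candidates_eq_empty_iff, typeOf] using sum_edgeProb_avoid m T s fun _ => True

lemma sum_uniform_candidates (P : AgentType) (ω : Edges s) :
    ∑ i : Waiting s, (if i ∈ candidates P ω then 1 / ((candidates P ω).card : ℝ) else 0)
      = 1 - if candidates P ω = ∅ then 1 else 0 := by
  rw [Finset.sum_ite_mem, Finset.univ_inter, Finset.sum_const, nsmul_eq_mul]
  split_ifs with h
  · simp [h]
  · rw [mul_one_div_cancel (by simpa using h), sub_zero]

lemma sum_uniform_candidates_preferred (P : AgentType) (ω : Edges s) :
    ∑ i with typeOf i = P, (if i ∈ candidates P ω then 1 / ((candidates P ω).card : ℝ) else 0)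
      = 1 - if ∀ i, typeOf i = P → ω i ≠ (true, true) then 1 else 0 := by
  split_ifs with h
  · rw [sub_self]
    exact Finset.sum_eq_zero fun i hi => if_neg fun hi' =>
      h i (Finset.mem_filter.1 hi).2 (mem_candidates.1 hi').1
  · have hne : candidates P ω ≠ ∅ := fun h' => h fun i _ => candidates_eq_empty_iff.1 h' i
    have hall := sum_uniform_candidates P ω
    rw [if_neg hne] at hall
    rw [← hall]
    exact Finset.sum_subset (Finset.filter_subset _ _) fun i _ hi => if_neg fun hi' =>
      (mem_candidates.1 hi').2.elim (fun hP => hi (by simp [hP])) h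

lemma sum_partnerProb (m : Market) (P T : AgentType) (s : State) :
    ∑ i, partnerProb m P T s i = 1 - stayProb m P T s := by
  simp only [partnerProb]
  rw [Finset.sum_comm]
  simp_rw [← Finset.mul_sum, sum_uniform_candidates, mul_sub, mul_one, Finset.sum_sub_distrib,
    sum_edgeProb, stayProb]

lemma sum_partnerProb_preferred (m : Market) (P T : AgentType) (s : State) :
    ∑ i with typeOf i = P, partnerProb m P T s i
      = 1 - ∏ i : Waiting s with typeOf i = P, m.miss T (typeOf i) := by
  simp only [partnerProb]
  rw [Finset.sum_comm]
  simp_rw [← Finset.mul_sum, sum_uniform_candidates_preferred, mul_sub, mul_one,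
    Finset.sum_sub_distrib, sum_edgeProb, sum_edgeProb_avoid]

lemma sum_partnerProb_inl (m : Market) (T : AgentType) (s : State) :
    ∑ j : Fin s.1, partnerProb m .H T s (.inl j) = 1 - m.miss T .H ^ s.1 := by
  have h := sum_partnerProb_preferred m .H T s
  rw [Finset.sum_filter, Finset.prod_filter] at h
  simpa [typeOf] using h

lemma sum_partnerProb_inr (m : Market) (T : AgentType) (s : State) :
    ∑ j : Fin s.2, partnerProb m .H T s (.inr j)
      = m.miss T .H ^ s.1 * (1 - m.miss T .E ^ s.2) := by
  have h := sum_partnerProb m .H T s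
  rw [Fintype.sum_sum_type, sum_partnerProb_inl, stayProb_eq] at h
  linear_combination h

lemma partnerProb_comp_perm (m : Market) (P T : AgentType) (σ : Equiv.Perm (Waiting s))
    (hσ : ∀ i, typeOf (σ i) = typeOf i) (i : Waiting s) :
    partnerProb m P T s (σ i) = partnerProb m P T s i := by
  have hmem (ω : Edges s) (j : Waiting s) : j ∈ candidates P (ω ∘ σ) ↔ σ j ∈ candidates P ω := by
    rw [mem_candidates, mem_candidates,
      ← σ.forall_congr_right (q := fun k => typeOf k = P → ω k ≠ (true, true))]
    simp only [hσ, Function.comp]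
  have hcard (ω : Edges s) : (candidates P (ω ∘ σ)).card = (candidates P ω).card :=
    Finset.card_equiv σ (hmem ω)
  have hedge (ω : Edges s) : edgeProb m T (ω ∘ σ) = edgeProb m T ω :=
    Fintype.prod_equiv σ _ _ fun j => by simp only [hσ, Function.comp]
  refine Fintype.sum_equiv (σ.symm.arrowCongr (Equiv.refl _)) _ _ fun ω => ?_
  change _ = edgeProb m T (ω ∘ σ) *
    if i ∈ candidates P (ω ∘ σ) then 1 / ((candidates P (ω ∘ σ)).card : ℝ) else 0
  simp only [hmem, hcard, hedge]

lemma partnerProb_eq_of_typeOf_eq (m : Market) (P T : AgentType) {i j : Waiting s}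
    (h : typeOf i = typeOf j) : partnerProb m P T s i = partnerProb m P T s j := by
  have hswap (k : Waiting s) : typeOf (Equiv.swap i j k) = typeOf k := by
    rw [Equiv.swap_apply_def]
    split_ifs with hi hj
    · rw [hi, h]
    · rw [hj, h]
    · rfl
  simpa using (partnerProb_comp_perm m P T (Equiv.swap i j) hswap i).symm

lemma bern_nonneg {p : ℝ} (hp : p ∈ Icc 0 1) (b : Bool) : 0 ≤ bern p b := by
  unfold bern; split_ifs <;> linarith [hp.1, hp.2]

lemma edgeProb_nonneg (hp : ∀ S, m.prob S ∈ Icc 0 1) (T : AgentType) (ω : Edges s) :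
    0 ≤ edgeProb m T ω :=
  Finset.prod_nonneg fun _ _ => mul_nonneg (bern_nonneg (hp _) _) (bern_nonneg (hp _) _)

lemma uniform_candidates_nonneg (P : AgentType) (ω : Edges s) (i : Waiting s) :
    0 ≤ if i ∈ candidates P ω then 1 / ((candidates P ω).card : ℝ) else 0 := by
  split_ifs <;> positivity

lemma partnerProb_nonneg (hp : ∀ S, m.prob S ∈ Icc 0 1) (P T : AgentType) (s : State)
    (i : Waiting s) : 0 ≤ partnerProb m P T s i :=
  Finset.sum_nonneg fun _ _ =>
    mul_nonneg (edgeProb_nonneg hp _ _) (uniform_candidates_nonneg _ _ _)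

lemma stayProb_nonneg (hp : ∀ S, m.prob S ∈ Icc 0 1) (P T : AgentType) (s : State) :
    0 ≤ stayProb m P T s :=
  Finset.sum_nonneg fun _ _ => mul_nonneg (edgeProb_nonneg hp _ _) (by split_ifs <;> simp)

/-- Markets with positive arrival rates and positive compatibility probabilities. -/
structure Market.Regular (m : Market) : Prop where
  rate_pos : ∀ T, 0 < m.rate T
  prob_pos : ∀ T, 0 < m.prob T
  prob_le_one : ∀ T, m.prob T ≤ 1

namespace Market.Regular

variable (hm : m.Regular)
include hm

lemma prob_mem_Icc (T : AgentType) : m.prob T ∈ Icc 0 1 := ⟨(hm.prob_pos T).le, hm.prob_le_one T⟩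

lemma prob_mul_prob_pos (T S : AgentType) : 0 < m.prob T * m.prob S :=
  mul_pos (hm.prob_pos T) (hm.prob_pos S)

lemma prob_mul_prob_le_one (T S : AgentType) : m.prob T * m.prob S ≤ 1 :=
  mul_le_one₀ (hm.prob_le_one T) (hm.prob_pos S).le (hm.prob_le_one S)

lemma miss_nonneg (T S : AgentType) : 0 ≤ m.miss T S := sub_nonneg.2 (hm.prob_mul_prob_le_one T S)

lemma miss_lt_one (T S : AgentType) : m.miss T S < 1 := sub_lt_self 1 (hm.prob_mul_prob_pos T S)

lemma miss_pow_mem_Icc (T S : AgentType) (n : ℕ) : m.miss T S ^ n ∈ Icc 0 1 :=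
  ⟨pow_nonneg (hm.miss_nonneg T S) n,
    pow_le_one₀ (hm.miss_nonneg T S) (hm.miss_lt_one T S).le⟩

lemma partnerProb_nonneg (P T : AgentType) (s : State) (i : Waiting s) :
    0 ≤ partnerProb m P T s i :=
  DynMarket.partnerProb_nonneg hm.prob_mem_Icc P T s i

lemma stayProb_nonneg (P T : AgentType) (s : State) : 0 ≤ stayProb m P T s :=
  DynMarket.stayProb_nonneg hm.prob_mem_Icc P T s

/-- With positive probability the newcomer is mutually compatible with everyone. -/
lemma partnerProb_pos (T : AgentType) {i : Waiting s}
    (hi : typeOf i = P ∨ ∀ k : Waiting s, typeOf k ≠ P) : 0 < partnerProb m P T s i := by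
  let ω : Edges s := fun _ => (true, true)
  have hmem : i ∈ candidates P ω :=
    mem_candidates.2 ⟨rfl, hi.imp_right fun h k hk => absurd hk (h k)⟩
  have hcard : (0 : ℝ) < (candidates P ω).card := Nat.cast_pos.2 (Finset.card_pos.2 ⟨i, hmem⟩)
  have hω : 0 < edgeProb m T ω :=
    Finset.prod_pos fun j _ => by simpa [ω, bern] using hm.prob_mul_prob_pos T (typeOf j)
  refine Finset.sum_pos' (fun _ _ => mul_nonneg (edgeProb_nonneg hm.prob_mem_Icc _ _)
    (uniform_candidates_nonneg _ _ _)) ⟨ω, Finset.mem_univ ω, ?_⟩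
  rw [if_pos hmem]
  positivity

end Market.Regular

end Policy

section Chain

variable {m : Market}

lemma sum_agentType {M : Type*} [AddCommMonoid M] (f : AgentType → M) :
    ∑ T, f T = f .H + f .E := by
  rw [show (Finset.univ : Finset AgentType) = {.H, .E} from rfl, Finset.sum_pair (by simp)]

/-- Expectation of `F` after one arrival in state `s`, under BilateralMatch(`P`). -/
def Market.step (m : Market) (P : AgentType) (F : State → ℝ) (s : State) : ℝ :=
  ∑ T, m.rate T / m.totalRate * (stayProb m P T s * F (addAgent T s) +
    ∑ i : Waiting s, partnerProb m P T s i * F (removeAgent (typeOf i) s))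

/-- Generator of the Markov chain under BilateralMatch(`P`). -/
def Market.gen (m : Market) (P : AgentType) (F : State → ℝ) (s : State) : ℝ :=
  ∑ T, m.rate T * (stayProb m P T s * (F (addAgent T s) - F s) +
    ∑ i : Waiting s, partnerProb m P T s i * (F (removeAgent (typeOf i) s) - F s))

namespace Market.Regular

variable (hm : m.Regular)
include hm

lemma totalRate_pos : 0 < m.totalRate := by
  rw [Market.totalRate, sum_agentType]
  exact add_pos (hm.rate_pos _) (hm.rate_pos _)

lemma step_eq (P : AgentType) (F : State → ℝ) (s : State) :
    m.step P F s = F s + m.gen P F s / m.totalRate := by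
  have hrate : ∑ T, m.rate T / m.totalRate = 1 := by
    rw [← Finset.sum_div]
    exact div_self hm.totalRate_pos.ne'
  have hsplit (T : AgentType) :
      stayProb m P T s * F (addAgent T s)
        + ∑ i : Waiting s, partnerProb m P T s i * F (removeAgent (typeOf i) s)
      = F s + (stayProb m P T s * (F (addAgent T s) - F s)
        + ∑ i : Waiting s, partnerProb m P T s i * (F (removeAgent (typeOf i) s) - F s)) := by
    simp_rw [mul_sub, Finset.sum_sub_distrib, ← Finset.sum_mul, sum_partnerProb]
    ring
  simp_rw [Market.step, hsplit, mul_add (_ / _) (F s), Finset.sum_add_distrib, ← Finset.sum_mul,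
    hrate, one_mul, Market.gen, Finset.sum_div, div_mul_eq_mul_div]

lemma step_nonneg (P : AgentType) {F : State → ℝ} (hF : ∀ s, 0 ≤ F s) (s : State) :
    0 ≤ m.step P F s :=
  Finset.sum_nonneg fun T _ => mul_nonneg (div_nonneg (hm.rate_pos T).le hm.totalRate_pos.le) <|
    add_nonneg (mul_nonneg (hm.stayProb_nonneg P T s) (hF _)) <|
      Finset.sum_nonneg fun i _ => mul_nonneg (hm.partnerProb_nonneg P T s i) (hF _)

lemma ofReal_transitionRate (P : AgentType) (s s' : State) :
    ENNReal.ofReal (transitionRate m P s s') = ∑ T, ENNReal.ofReal (m.rate T) *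
      ((if s' = addAgent T s then .ofReal (stayProb m P T s) else 0) +
        ∑ i : Waiting s, if s' = removeAgent (typeOf i) s then
          .ofReal (partnerProb m P T s i) else 0) := by
  have hstay (T : AgentType) : 0 ≤ if s' = addAgent T s then stayProb m P T s else 0 :=
    ite_nonneg (hm.stayProb_nonneg P T s) le_rfl
  have hpartner (T : AgentType) (i : Waiting s) :
      0 ≤ if s' = removeAgent (typeOf i) s then partnerProb m P T s i else 0 :=
    ite_nonneg (hm.partnerProb_nonneg P T s i) le_rfl
  have hsum (T : AgentType) := Finset.sum_nonneg fun i (_ : i ∈ Finset.univ) => hpartner T i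
  simp only [transitionRate, arrivalTransition]
  rw [ENNReal.ofReal_sum_of_nonneg fun T _ =>
    mul_nonneg (hm.rate_pos T).le (add_nonneg (hstay T) (hsum T))]
  refine Finset.sum_congr rfl fun T _ => ?_
  rw [ENNReal.ofReal_mul (hm.rate_pos T).le, ENNReal.ofReal_add (hstay T) (hsum T),
    ENNReal.ofReal_sum_of_nonneg fun i _ => hpartner T i]
  simp only [apply_ite ENNReal.ofReal, ENNReal.ofReal_zero]

lemma tsum_transitionRate_mul (P : AgentType) {F : State → ℝ} (hF : ∀ s, 0 ≤ F s) (s : State) :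
    ∑' s', ENNReal.ofReal (transitionRate m P s s') * .ofReal (F s')
      = .ofReal m.totalRate * .ofReal (m.step P F s) := by
  have hstay (T : AgentType) := mul_nonneg (hm.stayProb_nonneg P T s) (hF (addAgent T s))
  have hpartner (T : AgentType) (i : Waiting s) :=
    mul_nonneg (hm.partnerProb_nonneg P T s i) (hF (removeAgent (typeOf i) s))
  have hsum (T : AgentType) := Finset.sum_nonneg fun i (_ : i ∈ Finset.univ) => hpartner T i
  simp_rw [hm.ofReal_transitionRate, Finset.sum_mul, mul_assoc, add_mul, Finset.sum_mul, ite_mul,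
    zero_mul]
  rw [Summable.tsum_finsetSum fun _ _ => ENNReal.summable]
  simp_rw [ENNReal.tsum_mul_left, ENNReal.tsum_add,
    Summable.tsum_finsetSum fun _ _ => ENNReal.summable, tsum_ite_eq]
  rw [← ENNReal.ofReal_mul hm.totalRate_pos.le, Market.step, Finset.mul_sum,
    ENNReal.ofReal_sum_of_nonneg fun T _ => by
      rw [← mul_assoc, mul_div_cancel₀ _ hm.totalRate_pos.ne']
      exact mul_nonneg (hm.rate_pos T).le (add_nonneg (hstay T) (hsum T))]
  refine Finset.sum_congr rfl fun T _ => ?_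
  rw [← mul_assoc, mul_div_cancel₀ _ hm.totalRate_pos.ne', ENNReal.ofReal_mul (hm.rate_pos T).le,
    ENNReal.ofReal_add (hstay T) (hsum T), ENNReal.ofReal_sum_of_nonneg fun i _ => hpartner T i,
    ENNReal.ofReal_mul (hm.stayProb_nonneg P T s)]
  simp_rw [ENNReal.ofReal_mul (hm.partnerProb_nonneg P T s _)]

lemma tsum_transitionRate (P : AgentType) (s : State) :
    ∑' s', ENNReal.ofReal (transitionRate m P s s') = .ofReal m.totalRate := by
  simpa [hm.step_eq, Market.gen] using
    hm.tsum_transitionRate_mul P (F := fun _ => 1) (fun _ => zero_le_one) s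

/-- Kernel of the chain embedded at the arrival epochs, under BilateralMatch(`P`). -/
def jump (P : AgentType) (s : State) : PMF State :=
  ⟨fun s' => .ofReal (transitionRate m P s s') / .ofReal m.totalRate, by
    rw [ENNReal.summable.hasSum_iff]
    simp_rw [div_eq_mul_inv]
    rw [ENNReal.tsum_mul_right, hm.tsum_transitionRate, ← div_eq_mul_inv]
    exact ENNReal.div_self (ENNReal.ofReal_pos.2 hm.totalRate_pos).ne' ENNReal.ofReal_ne_top⟩

lemma jump_apply (P : AgentType) (s s' : State) :
    hm.jump P s s' = .ofReal (transitionRate m P s s') / .ofReal m.totalRate := rfl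

lemma mean_jump (P : AgentType) {F : State → ℝ} (hF : ∀ s, 0 ≤ F s) (s : State) :
    mean (hm.jump P s) (fun s' => .ofReal (F s')) = .ofReal (m.step P F s) := by
  simp_rw [mean, jump_apply, div_eq_mul_inv, mul_right_comm, ENNReal.tsum_mul_right]
  rw [hm.tsum_transitionRate_mul P hF, ← div_eq_mul_inv, mul_comm, ENNReal.mul_div_cancel_right
    (ENNReal.ofReal_pos.2 hm.totalRate_pos).ne' ENNReal.ofReal_ne_top]

lemma isSteadyState_iff {P : AgentType} {π : PMF State} :
    IsSteadyState m P π ↔ π.bind (hm.jump P) = π := by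
  rw [IsSteadyState, PMF.ext_iff]
  refine forall_congr' fun s => ?_
  simp_rw [PMF.bind_apply, jump_apply, div_eq_mul_inv, ← mul_assoc, ENNReal.tsum_mul_right,
    hm.tsum_transitionRate, ← div_eq_mul_inv]
  rw [eq_comm (b := π s), ENNReal.eq_div_iff (ENNReal.ofReal_pos.2 hm.totalRate_pos).ne'
    ENNReal.ofReal_ne_top, mul_comm, eq_comm]

lemma mean_step {P : AgentType} {π : PMF State} (hπ : IsSteadyState m P π) {F : State → ℝ}
    (hF : ∀ s, 0 ≤ F s) :
    mean π (fun s => .ofReal (m.step P F s)) = mean π fun s => .ofReal (F s) := by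
  simp_rw [← hm.mean_jump P hF]
  rw [← mean_bind, hm.isSteadyState_iff.1 hπ]

lemma mean_jump_add_le {P : AgentType} {F f g : State → ℝ} (hF : ∀ s, 0 ≤ F s)
    (hg : ∀ s, 0 ≤ g s) (h : ∀ s, m.gen P F s + g s ≤ f s) (s : State) :
    mean (hm.jump P s) (fun s' => .ofReal (F s')) + .ofReal (g s / m.totalRate)
      ≤ .ofReal (F s) + .ofReal (f s / m.totalRate) := by
  rw [hm.mean_jump P hF, ← ENNReal.ofReal_add (hm.step_nonneg P hF s)
    (div_nonneg (hg s) hm.totalRate_pos.le), hm.step_eq, add_assoc, ← add_div]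
  refine (ENNReal.ofReal_le_ofReal ?_).trans ENNReal.ofReal_add_le
  gcongr
  exacts [hm.totalRate_pos.le, h s]

lemma mean_le_mean_of_gen_add_le {P : AgentType} {π : PMF State} (hπ : IsSteadyState m P π)
    {F f g : State → ℝ} (hF : ∀ s, 0 ≤ F s) (hg : ∀ s, 0 ≤ g s)
    (h : ∀ s, m.gen P F s + g s ≤ f s) :
    mean π (fun s => .ofReal (g s)) ≤ mean π fun s => .ofReal (f s) := by
  have hmean := mean_le_mean_of_drift (hm.isSteadyState_iff.1 hπ)
    (fun _ => ENNReal.ofReal_ne_top) (hm.mean_jump_add_le hF hg h)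
  simp_rw [ENNReal.ofReal_div_of_pos hm.totalRate_pos, div_eq_mul_inv,
    mul_comm _ (ENNReal.ofReal m.totalRate)⁻¹, mean_const_mul] at hmean
  exact (ENNReal.mul_le_mul_iff_right (by simp)
    (by simpa using hm.totalRate_pos)).1 hmean

end Market.Regular

end Chain

section Ergodicity

variable {m : Market}

lemma natCast_mul_pow_le_inv_one_sub {x : ℝ} (h0 : 0 ≤ x) (h1 : x < 1) (n : ℕ) :
    n * x ^ n ≤ (1 - x)⁻¹ := by
  calc n * x ^ n = ∑ _i ∈ Finset.range n, x ^ n := by simp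
    _ ≤ ∑ i ∈ Finset.range n, x ^ i := Finset.sum_le_sum fun i hi =>
        pow_le_pow_of_le_one h0 h1.le (Finset.mem_range.1 hi).le
    _ ≤ ∑' i, x ^ i := (summable_geometric_of_lt_one h0 h1).sum_le_tsum _ fun i _ => pow_nonneg h0 i
    _ = (1 - x)⁻¹ := tsum_geometric_of_lt_one h0 h1

/-- Number of waiting agents. -/
def population (s : State) : ℕ := s.1 + s.2

lemma population_addAgent (T : AgentType) (s : State) :
    population (addAgent T s) = population s + 1 := by
  cases T <;> simp only [population, addAgent] <;> ring

lemma population_removeAgent_add_one {s : State} (i : Waiting s) :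
    population (removeAgent (typeOf i) s) + 1 = population s := by
  rcases i with j | j <;> have := j.pos <;> simp only [population, removeAgent, typeOf,
    Sum.elim_inl, Sum.elim_inr] <;> omega

lemma finite_setOf_population_le {B : ℝ≥0∞} (hB : B ≠ ⊤) :
    {s | (population s : ℝ≥0∞) ≤ B}.Finite := by
  obtain ⟨n, hn⟩ := ENNReal.exists_nat_gt hB
  refine ((Set.finite_Iic n).prod (Set.finite_Iic n)).subset fun s hs => ?_
  have hle : population s ≤ n := Nat.cast_le.1 (le_trans hs.out hn.le)
  exact ⟨(Nat.le_add_right _ _).trans hle, (Nat.le_add_left _ _).trans hle⟩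

lemma gen_population_sq (m : Market) (P : AgentType) (s : State) :
    m.gen P (fun s => (population s : ℝ) ^ 2) s = m.totalRate * (1 - 2 * population s)
      + 4 * ∑ T, m.rate T * (population s * stayProb m P T s) := by
  have hremove (i : Waiting s) : (population (removeAgent (typeOf i) s) : ℝ) = population s - 1 :=
    eq_sub_of_add_eq (by exact_mod_cast population_removeAgent_add_one i)
  simp_rw [Market.gen, population_addAgent, hremove, ← Finset.sum_mul, sum_partnerProb]
  rw [Market.totalRate, Finset.sum_mul, Finset.mul_sum, ← Finset.sum_add_distrib]
  refine Finset.sum_congr rfl fun T _ => ?_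
  push_cast
  ring

/-- Average number of waiting agents of type `H`. -/
def meanH (π : PMF State) : ℝ≥0∞ := mean π fun s => (s.1 : ℝ≥0∞)

namespace Market.Regular

variable (hm : m.Regular)
include hm

lemma population_mul_stayProb_le (P T : AgentType) (s : State) :
    population s * stayProb m P T s ≤ (1 - m.miss T .H)⁻¹ + (1 - m.miss T .E)⁻¹ := by
  have hH := natCast_mul_pow_le_inv_one_sub (hm.miss_nonneg T .H) (hm.miss_lt_one T .H) s.1
  have hE := natCast_mul_pow_le_inv_one_sub (hm.miss_nonneg T .E) (hm.miss_lt_one T .E) s.2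
  obtain ⟨hH0, hH1⟩ := hm.miss_pow_mem_Icc T .H s.1
  obtain ⟨hE0, hE1⟩ := hm.miss_pow_mem_Icc T .E s.2
  calc population s * stayProb m P T s
      = s.1 * m.miss T .H ^ s.1 * m.miss T .E ^ s.2
        + s.2 * m.miss T .E ^ s.2 * m.miss T .H ^ s.1 := by
        rw [stayProb_eq, population]; push_cast; ring
    _ ≤ s.1 * m.miss T .H ^ s.1 * 1 + s.2 * m.miss T .E ^ s.2 * 1 := by gcongr
    _ ≤ _ := by rw [mul_one, mul_one]; exact add_le_add hH hE

lemma exists_gen_population_sq_add_le (P : AgentType) :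
    ∃ C, ∀ s, m.gen P (fun s => (population s : ℝ) ^ 2) s + m.totalRate * population s ≤ C := by
  refine ⟨m.totalRate + 4 * ∑ T, m.rate T * ((1 - m.miss T .H)⁻¹ + (1 - m.miss T .E)⁻¹),
    fun s => ?_⟩
  have hsum : ∑ T, m.rate T * (population s * stayProb m P T s)
      ≤ ∑ T, m.rate T * ((1 - m.miss T .H)⁻¹ + (1 - m.miss T .E)⁻¹) :=
    Finset.sum_le_sum fun T _ =>
      mul_le_mul_of_nonneg_left (hm.population_mul_stayProb_le P T s) (hm.rate_pos T).le
  rw [gen_population_sq]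
  linarith [mul_nonneg hm.totalRate_pos.le (Nat.cast_nonneg (α := ℝ) (population s))]

lemma exists_steadyState (P : AgentType) : ∃ π, IsSteadyState m P π := by
  obtain ⟨C, hC⟩ := hm.exists_gen_population_sq_add_le P
  have hdrift := hm.mean_jump_add_le (fun s => sq_nonneg (population s : ℝ))
    (fun s => mul_nonneg hm.totalRate_pos.le (population s).cast_nonneg) hC
  simp_rw [mul_div_cancel_left₀ _ hm.totalRate_pos.ne', ENNReal.ofReal_natCast] at hdrift
  obtain ⟨π, hπ⟩ := exists_stationary_of_drift (o := (0, 0)) ENNReal.ofReal_ne_top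
    ENNReal.ofReal_ne_top (fun _ => finite_setOf_population_le) hdrift
  exact ⟨π, hm.isSteadyState_iff.2 hπ⟩

lemma jump_removeAgent_ne_zero {P : AgentType} {s : State} {i : Waiting s}
    (hi : typeOf i = P ∨ ∀ k : Waiting s, typeOf k ≠ P) :
    hm.jump P s (removeAgent (typeOf i) s) ≠ 0 := by
  rw [jump_apply, ENNReal.div_ne_zero, hm.ofReal_transitionRate]
  refine ⟨fun h => ?_, ENNReal.ofReal_ne_top⟩
  have hH := (mul_eq_zero.1 (Finset.sum_eq_zero_iff.1 h .H (Finset.mem_univ _))).resolve_left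
    (ENNReal.ofReal_pos.2 (hm.rate_pos .H)).ne'
  have hi' := Finset.sum_eq_zero_iff.1 (add_eq_zero.1 hH).2 i (Finset.mem_univ i)
  rw [if_pos rfl] at hi'
  exact (ENNReal.ofReal_pos.2 (hm.partnerProb_pos .H hi)).ne' hi'

lemma reaches_empty (P : AgentType) (s : State) :
    Relation.ReflTransGen (fun a b => hm.jump P a b ≠ 0) s (0, 0) := by
  induction hn : population s generalizing s with
  | zero =>
    obtain ⟨h1, h2⟩ := Nat.add_eq_zero_iff.1 hn
    rw [show s = (0, 0) from Prod.ext h1 h2]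
  | succ n ih =>
    obtain ⟨i, hi⟩ : ∃ i : Waiting s, typeOf i = P ∨ ∀ k : Waiting s, typeOf k ≠ P := by
      by_cases hP : ∃ k : Waiting s, typeOf k = P
      · exact hP.imp fun _ => .inl
      · have : Nonempty (Waiting s) := Fintype.card_pos_iff.1 <| by
          simp only [Fintype.card_sum, Fintype.card_fin]; unfold population at hn; omega
        exact this.elim fun i => ⟨i, .inr (not_exists.1 hP)⟩
    have hpop := population_removeAgent_add_one i
    exact .head (hm.jump_removeAgent_ne_zero hi) (ih _ (by omega))

lemma existsUnique_steadyState (P : AgentType) : ∃! π, IsSteadyState m P π := by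
  obtain ⟨π, hπ⟩ := hm.exists_steadyState P
  exact ⟨π, hπ, fun π' hπ' => stationary_unique (hm.reaches_empty P)
    (hm.isSteadyState_iff.1 hπ') (hm.isSteadyState_iff.1 hπ)⟩

lemma meanH_ne_top {P : AgentType} {π : PMF State} (hπ : IsSteadyState m P π) : meanH π ≠ ⊤ := by
  obtain ⟨C, hC⟩ := hm.exists_gen_population_sq_add_le P
  have hbound := hm.mean_le_mean_of_gen_add_le hπ (fun s => sq_nonneg (population s : ℝ))
    (fun s => mul_nonneg hm.totalRate_pos.le (population s).cast_nonneg) hC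
  simp_rw [ENNReal.ofReal_mul hm.totalRate_pos.le, mean_const_mul, mean_const,
    ENNReal.ofReal_natCast] at hbound
  have hfin : mean π (fun s => (population s : ℝ≥0∞)) ≠ ⊤ := fun h => by
    simp [h, ENNReal.mul_top, hm.totalRate_pos] at hbound
  exact ne_top_of_le_ne_top hfin (mean_mono π fun s => Nat.cast_le.2 (Nat.le_add_right _ _))

end Market.Regular

end Ergodicity

section LittleLaw

variable {m : Market}

/-- One arrival, seen from a waiting agent of type `H`, as an operator on functions of the state of
the other waiting agents: mass is lost when the agent is matched. -/
def Market.taggedStep (m : Market) (P : AgentType) : Module.End ℝ (State → ℝ) where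
  toFun F o := ∑ T : AgentType, m.rate T / m.totalRate *
    (stayProb m P T (addAgent .H o) * F (addAgent T o) +
      ∑ i ∈ Finset.univ.erase (tagged o),
        partnerProb m P T (addAgent .H o) i * F (removeAgent (typeOf i) o))
  map_add' F G := by
    funext o
    simp only [Pi.add_apply, mul_add, Finset.sum_add_distrib]
    ring
  map_smul' c F := by
    funext o
    simp only [Pi.smul_apply, smul_eq_mul, RingHom.id_apply, Finset.mul_sum, mul_add]
    simp only [mul_left_comm c]

lemma taggedStep_apply (m : Market) (P : AgentType) (F : State → ℝ) (o : State) :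
    m.taggedStep P F o = ∑ T : AgentType, m.rate T / m.totalRate *
      (stayProb m P T (addAgent .H o) * F (addAgent T o) +
        ∑ i ∈ Finset.univ.erase (tagged o),
          partnerProb m P T (addAgent .H o) i * F (removeAgent (typeOf i) o)) := rfl

lemma stillWaiting_eq_taggedStep_pow (m : Market) (P : AgentType) (n : ℕ) :
    stillWaiting m P n = (m.taggedStep P ^ n) 1 := by
  induction n with
  | zero => rfl
  | succ n ih => rw [pow_succ', Module.End.mul_apply, ← ih]; rfl

/-- Sum over the waiting agents of type `H` of the value of `F` at the state of the other agents. -/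
def sumTagged (F : State → ℝ) (s : State) : ℝ := s.1 * F (removeAgent .H s)

lemma sumTagged_addAgent (F : State → ℝ) (o : State) :
    sumTagged F (addAgent .H o) = (o.1 + 1) * F o := by
  simp [sumTagged, addAgent, removeAgent]

lemma succ_mul_sum_erase_tagged (m : Market) (P T : AgentType) (F : State → ℝ) (o : State) :
    (o.1 + 1) * ∑ i ∈ Finset.univ.erase (tagged o),
        partnerProb m P T (addAgent .H o) i * F (removeAgent (typeOf i) o)
      = ∑ i, partnerProb m P T (addAgent .H o) i
          * sumTagged F (removeAgent (typeOf i) (addAgent .H o)) := by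
  have hexch (j : Fin (addAgent .H o).1) : partnerProb m P T (addAgent .H o) (.inl j)
      = partnerProb m P T (addAgent .H o) (tagged o) :=
    partnerProb_eq_of_typeOf_eq m P T rfl
  have htype : typeOf (tagged o) = .H := rfl
  rw [Finset.sum_erase_eq_sub (Finset.mem_univ _), Fintype.sum_sum_type, Fintype.sum_sum_type,
    htype]
  simp only [hexch, typeOf, Sum.elim_inl, Sum.elim_inr, Finset.sum_const, Finset.card_univ,
    Fintype.card_fin, nsmul_eq_mul, ← Finset.sum_mul, sumTagged]
  simp only [addAgent, removeAgent, Nat.add_sub_cancel, Prod.eta]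
  push_cast
  ring

lemma step_sumTagged (m : Market) (P : AgentType) (F : State → ℝ) (s : State) :
    m.step P (sumTagged F) s
      = sumTagged (m.taggedStep P F) s + m.rate .H / m.totalRate * (stayProb m P .H s * F s) := by
  obtain ⟨h, e⟩ := s
  cases h with
  | zero =>
    simp [Market.step, sum_agentType, sumTagged, addAgent, removeAgent, typeOf]
  | succ h =>
    change m.step P (sumTagged F) (addAgent .H (h, e)) = sumTagged _ (addAgent .H (h, e)) + _
    have herase (T : AgentType) := succ_mul_sum_erase_tagged m P T F (h, e)
    have hadd : addAgent .E (addAgent .H (h, e)) = addAgent .H (addAgent .E (h, e)) := rfl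
    rw [sumTagged_addAgent, taggedStep_apply, Market.step, sum_agentType, sum_agentType,
      ← herase, ← herase, hadd, sumTagged_addAgent, sumTagged_addAgent]
    simp only [addAgent]
    push_cast
    ring

/-- Weights of the states seen by the waiting agents of type `H` when the state has law `π`: each
agent counts once, at the state of the other agents. -/
def taggedWeights (π : PMF State) (o : State) : ℝ≥0∞ := π (addAgent .H o) * (o.1 + 1 : ℕ)

lemma mean_taggedWeights (π : PMF State) (F : State → ℝ) :
    mean (taggedWeights π) (fun o => .ofReal (F o)) = mean π fun s => .ofReal (sumTagged F s) := by
  have hinj : Function.Injective (addAgent .H) := fun a b h => by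
    simpa [addAgent, Prod.ext_iff] using h
  have hsupport : Function.support (fun s => π s * ENNReal.ofReal (sumTagged F s))
      ⊆ range (addAgent .H) := fun ⟨h, e⟩ hs => by
    cases h with
    | zero => simp [sumTagged] at hs
    | succ h => exact ⟨(h, e), rfl⟩
  rw [mean, mean, ← hinj.tsum_eq hsupport]
  refine tsum_congr fun o => ?_
  rw [sumTagged_addAgent, taggedWeights, mul_assoc, ENNReal.ofReal_mul (by positivity),
    ← Nat.cast_succ, ENNReal.ofReal_natCast]

lemma tsum_taggedWeights (π : PMF State) : ∑' o, taggedWeights π o = meanH π := by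
  simpa [mean, sumTagged, meanH] using mean_taggedWeights π 1

lemma lintegral_erlang {l : ℝ} (hl : 0 < l) (n : ℕ) :
    ∫⁻ t in Ioi (0 : ℝ), ENNReal.ofReal (Real.exp (-(l * t)) * (l * t) ^ n / (n.factorial : ℝ))
      = .ofReal l⁻¹ := by
  have hgamma : ∫⁻ t in Ioi (0 : ℝ), ProbabilityTheory.gammaPDF (n + 1) l t = 1 := by
    rw [MeasureTheory.setLIntegral_congr MeasureTheory.Ioi_ae_eq_Ici, ← zero_add (∫⁻ _ in Ici _, _),
      ← ProbabilityTheory.lintegral_gammaPDF_of_nonpos (a := n + 1) (r := l) le_rfl,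
      ← MeasureTheory.lintegral_union measurableSet_Ici (Iio_disjoint_Ici le_rfl), Iio_union_Ici,
      MeasureTheory.setLIntegral_univ]
    exact ProbabilityTheory.lintegral_gammaPDF_eq_one (by positivity) hl
  rw [← mul_one (ENNReal.ofReal l⁻¹), ← hgamma,
    ← MeasureTheory.lintegral_const_mul' _ _ ENNReal.ofReal_ne_top]
  refine MeasureTheory.setLIntegral_congr_fun measurableSet_Ioi fun t ht => ?_
  rw [mem_Ioi] at ht
  rw [ProbabilityTheory.gammaPDF_of_nonneg ht.le, ← ENNReal.ofReal_mul (by positivity),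
    Real.Gamma_nat_eq_factorial, add_sub_cancel_right, Real.rpow_natCast, ← Nat.cast_add_one,
    Real.rpow_natCast, mul_pow, pow_succ]
  congr 1
  field_simp

namespace Market.Regular

variable (hm : m.Regular)
include hm

lemma taggedStep_nonneg (P : AgentType) (F : State → ℝ) (hF : 0 ≤ F) : 0 ≤ m.taggedStep P F := by
  intro o
  rw [Pi.zero_apply, taggedStep_apply]
  exact Finset.sum_nonneg fun T _ =>
    mul_nonneg (div_nonneg (hm.rate_pos T).le hm.totalRate_pos.le) <|
      add_nonneg (mul_nonneg (hm.stayProb_nonneg P T _) (hF _)) <|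
        Finset.sum_nonneg fun i _ => mul_nonneg (hm.partnerProb_nonneg P T _ i) (hF _)

lemma taggedStep_one_lt (o : State) : m.taggedStep .H 1 o < 1 := by
  have hsum (T : AgentType) : stayProb m .H T (addAgent .H o)
      + ∑ i ∈ Finset.univ.erase (tagged o), partnerProb m .H T (addAgent .H o) i
      = 1 - partnerProb m .H T (addAgent .H o) (tagged o) := by
    rw [Finset.sum_erase_eq_sub (Finset.mem_univ _), sum_partnerProb]
    ring
  simp only [taggedStep_apply, Pi.one_apply, mul_one, hsum]
  calc ∑ T, m.rate T / m.totalRate * (1 - partnerProb m .H T (addAgent .H o) (tagged o))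
      < ∑ T, m.rate T / m.totalRate :=
        Finset.sum_lt_sum_of_nonempty ⟨.H, Finset.mem_univ _⟩ fun T _ =>
          mul_lt_of_lt_one_right (div_pos (hm.rate_pos T) hm.totalRate_pos)
            (sub_lt_self 1 (hm.partnerProb_pos T (.inl rfl)))
    _ = 1 := by rw [← Finset.sum_div]; exact div_self hm.totalRate_pos.ne'

lemma expectedWait_eq (P : AgentType) (o : State) :
    expectedWait m P o
      = .ofReal m.totalRate⁻¹ * ∑' n, ENNReal.ofReal ((m.taggedStep P ^ n) 1 o) := by
  simp_rw [expectedWait, waitingTail, stillWaiting_eq_taggedStep_pow]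
  rw [MeasureTheory.lintegral_tsum fun n => by fun_prop, ← ENNReal.tsum_mul_left]
  refine tsum_congr fun n => ?_
  rw [← lintegral_erlang hm.totalRate_pos n,
    ← MeasureTheory.lintegral_mul_const' _ _ ENNReal.ofReal_ne_top]
  refine MeasureTheory.setLIntegral_congr_fun measurableSet_Ioi fun t ht => ?_
  have hΛt : 0 < m.totalRate * t := mul_pos hm.totalRate_pos ht
  exact ENNReal.ofReal_mul (by positivity)

lemma mean_taggedWeights_taggedStep {P : AgentType} {π : PMF State} (hπ : IsSteadyState m P π)
    {F : State → ℝ} (hF : 0 ≤ F) :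
    mean (taggedWeights π) (fun o => .ofReal (F o))
      = mean (taggedWeights π) (fun o => .ofReal (m.taggedStep P F o))
        + mean (fun s => .ofReal (m.rate .H / m.totalRate) * (π s * .ofReal (stayProb m P .H s)))
          fun s => .ofReal (F s) := by
  have hsumTagged {G : State → ℝ} (hG : 0 ≤ G) (s : State) : 0 ≤ sumTagged G s :=
    mul_nonneg s.1.cast_nonneg (hG _)
  have hrate := div_nonneg (hm.rate_pos .H).le hm.totalRate_pos.le
  simp_rw [mean_taggedWeights]
  rw [← hm.mean_step hπ (hsumTagged hF)]
  simp_rw [step_sumTagged, mean, ← ENNReal.tsum_add]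
  refine tsum_congr fun s => ?_
  rw [ENNReal.ofReal_add (hsumTagged (hm.taggedStep_nonneg P F hF) s)
      (mul_nonneg hrate (mul_nonneg (hm.stayProb_nonneg P .H s) (hF s))),
    ENNReal.ofReal_mul hrate, ENNReal.ofReal_mul (hm.stayProb_nonneg P .H s)]
  ring

theorem ofReal_rate_mul_averageWaitH {π : PMF State} (hπ : IsSteadyState m .H π) :
    .ofReal (m.rate .H) * averageWaitH m .H π = meanH π := by
  have hmass := tsum_taggedWeights π
  rw [← hmass, tsum_eq_tsum_mean_pow_one (hm.taggedStep_nonneg .H)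
    (fun F => hm.mean_taggedWeights_taggedStep hπ) hm.taggedStep_one_lt
    (hmass ▸ hm.meanH_ne_top hπ)]
  simp_rw [averageWaitH, hm.expectedWait_eq, mean, div_eq_mul_inv,
    ENNReal.ofReal_mul (hm.rate_pos .H).le]
  rw [ENNReal.tsum_comm, ← ENNReal.tsum_mul_left]
  refine tsum_congr fun s => ?_
  rw [ENNReal.tsum_mul_left]
  ring

lemma averageWaitH_ne_top {π : PMF State} (hπ : IsSteadyState m .H π) :
    averageWaitH m .H π ≠ ⊤ := fun h => hm.meanH_ne_top hπ <| by
  rw [← hm.ofReal_rate_mul_averageWaitH hπ, h,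
    ENNReal.mul_top (ENNReal.ofReal_pos.2 (hm.rate_pos .H)).ne']

lemma toReal_averageWaitH {π : PMF State} (hπ : IsSteadyState m .H π) :
    (averageWaitH m .H π).toReal = (meanH π).toReal / m.rate .H := by
  rw [← hm.ofReal_rate_mul_averageWaitH hπ, ENNReal.toReal_mul,
    ENNReal.toReal_ofReal (hm.rate_pos .H).le, mul_div_cancel_left₀ _ (hm.rate_pos .H).ne']

end Market.Regular

end LittleLaw

section Asymptotics

variable {m : Market}

lemma exists_abs_sub_le_add_mul {g : ℝ → ℝ} (hg : StrictMono g) (x : ℝ) {δ : ℝ} (hδ : 0 < δ) :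
    ∃ M, 0 ≤ M ∧ ∀ y, |y - x| ≤ δ + M * ((y - x) * (g y - g x)) := by
  set c := min (g (x + δ) - g x) (g x - g (x - δ))
  have hc : 0 < c :=
    lt_min (sub_pos.2 (hg (lt_add_of_pos_right x hδ))) (sub_pos.2 (hg (sub_lt_self x hδ)))
  refine ⟨c⁻¹, inv_nonneg.2 hc.le, fun y => ?_⟩
  have hfar : |y - x| ≤ δ ∨ |y - x| * c ≤ (y - x) * (g y - g x) := by
    rcases le_or_gt |y - x| δ with hnear | hfar
    · exact .inl hnear
    rcases lt_abs.1 hfar with hright | hleft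
    · refine .inr ?_
      rw [abs_of_pos (hδ.trans hright)]
      have hgy := hg.monotone (show x + δ ≤ y by linarith)
      exact mul_le_mul_of_nonneg_left ((min_le_left _ _).trans (by linarith))
        (hδ.trans hright).le
    · refine .inr ?_
      rw [abs_of_neg (by linarith), ← neg_mul_neg (y - x)]
      have hgy := hg.monotone (show y ≤ x - δ by linarith)
      exact mul_le_mul_of_nonneg_left ((min_le_right _ _).trans (by linarith)) (by linarith)
  have hmono : 0 ≤ (y - x) * (g y - g x) :=
    (monovary_id_iff.2 hg.monotone).symm.sub_mul_sub_nonneg x y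
  rw [inv_mul_eq_div]
  rcases hfar with hnear | hfar
  · exact hnear.trans (le_add_of_nonneg_right (div_nonneg hmono hc.le))
  · exact ((le_div_iff₀ hc).2 hfar).trans (le_add_of_nonneg_left hδ.le)

lemma gen_fst (m : Market) (G : ℕ → ℝ) (s : State) :
    m.gen .H (fun s => G s.1) s = m.lamH * stayProb m .H .H s * (G (s.1 + 1) - G s.1)
      + (∑ T, m.rate T * (1 - m.miss T .H ^ s.1)) * (G (s.1 - 1) - G s.1) := by
  simp only [Market.gen, Fintype.sum_sum_type, typeOf, Sum.elim_inl, Sum.elim_inr, addAgent,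
    removeAgent, ← Finset.sum_mul, sum_partnerProb_inl, sum_agentType, Market.rate]
  ring

lemma gen_snd (m : Market) (G : ℕ → ℝ) (s : State) :
    m.gen .H (fun s => G s.2) s = m.lamE * stayProb m .H .E s * (G (s.2 + 1) - G s.2)
      + (∑ T, m.rate T * (m.miss T .H ^ s.1 * (1 - m.miss T .E ^ s.2)))
        * (G (s.2 - 1) - G s.2) := by
  simp only [Market.gen, Fintype.sum_sum_type, typeOf, Sum.elim_inl, Sum.elim_inr, addAgent,
    removeAgent, ← Finset.sum_mul, sum_partnerProb_inr, sum_agentType, Market.rate]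
  ring

lemma gen_sq_fst (m : Market) (c : ℝ) (s : State) :
    m.gen .H (fun s => ((s.1 : ℝ) - c) ^ 2) s =
      m.lamH * stayProb m .H .H s * (1 + 2 * (s.1 - c))
        + (∑ T, m.rate T * (1 - m.miss T .H ^ s.1)) * (1 - 2 * (s.1 - c)) := by
  rw [gen_fst m (fun h => ((h : ℝ) - c) ^ 2)]
  obtain ⟨_ | h, e⟩ := s
  · simp only [pow_zero, sub_self, mul_zero, Finset.sum_const_zero, zero_mul]
    push_cast
    ring
  · simp only [Nat.add_sub_cancel]
    push_cast
    ring

lemma gen_sq_snd (m : Market) (s : State) :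
    m.gen .H (fun s => (s.2 : ℝ) ^ 2) s =
      m.lamE * stayProb m .H .E s * (1 + 2 * s.2)
        + (∑ T, m.rate T * (m.miss T .H ^ s.1 * (1 - m.miss T .E ^ s.2))) * (1 - 2 * s.2) := by
  rw [gen_snd m (fun e => (e : ℝ) ^ 2)]
  obtain ⟨h, _ | e⟩ := s
  · simp
  · simp only [Nat.add_sub_cancel]
    push_cast
    ring

namespace Market.Regular

variable (hm : m.Regular)
include hm

lemma lamH_pos : 0 < m.lamH := hm.rate_pos .H

lemma lamE_pos : 0 < m.lamE := hm.rate_pos .E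

lemma pE_pos : 0 < m.pE := hm.prob_pos .E

lemma mul_miss_pow_le (e : ℕ) : e * m.miss .E .E ^ e ≤ (m.pE ^ 2)⁻¹ := by
  have hmiss : 1 - m.miss .E .E = m.pE ^ 2 := by rw [sq]; exact sub_sub_cancel _ _
  exact hmiss ▸ natCast_mul_pow_le_inv_one_sub (hm.miss_nonneg .E .E) (hm.miss_lt_one .E .E) e

lemma one_sub_miss_pow_le (T S : AgentType) (n : ℕ) :
    1 - m.miss T S ^ n ≤ n * (m.prob T * m.prob S) := by
  have hbernoulli := one_add_mul_le_pow (a := -(m.prob T * m.prob S))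
    (by linarith [hm.prob_mul_prob_le_one T S]) n
  rw [← sub_eq_add_neg] at hbernoulli
  linarith [show m.miss T S ^ n = (1 - m.prob T * m.prob S) ^ n from rfl]

lemma gen_sq_snd_add_le (s : State) :
    m.gen .H (fun s => (s.2 : ℝ) ^ 2) s + 2 * m.lamE * (s.2 * m.miss .E .H ^ s.1)
      ≤ m.totalRate + 4 * m.lamE * (m.pE ^ 2)⁻¹ := by
  have hmul := hm.mul_miss_pow_le s.2
  have hz0 := (hm.miss_pow_mem_Icc .E .E s.2).1
  have hlamH := hm.lamH_pos.le
  have hlamE := hm.lamE_pos.le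
  rw [gen_sq_snd, stayProb_eq, Market.totalRate, sum_agentType, sum_agentType]
  simp only [Market.rate]
  obtain ⟨hu0, hu1⟩ := hm.miss_pow_mem_Icc .E .H s.1
  obtain ⟨hv0, hv1⟩ := hm.miss_pow_mem_Icc .H .H s.1
  obtain ⟨hw0, hw1⟩ := hm.miss_pow_mem_Icc .H .E s.2
  generalize m.miss .E .H ^ s.1 = u at *
  generalize m.miss .H .H ^ s.1 = v at *
  generalize m.miss .H .E ^ s.2 = w at *
  generalize m.miss .E .E ^ s.2 = z at *
  have hdeath : v * (1 - w) ≤ 1 := mul_le_one₀ hv1 (sub_nonneg.2 hw1) (sub_le_self _ hw0)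
  have hmatch : 0 ≤ 2 * s.2 * (m.lamH * (v * (1 - w))) := by
    have := sub_nonneg.2 hw1
    positivity
  have hbirth : u * (s.2 * z) ≤ (m.pE ^ 2)⁻¹ :=
    (mul_le_of_le_one_left (by positivity) hu1).trans hmul
  calc _ = m.lamH * (v * (1 - w)) + m.lamE * u + 4 * m.lamE * (u * (s.2 * z))
        - 2 * s.2 * (m.lamH * (v * (1 - w))) := by ring
    _ ≤ m.lamH * 1 + m.lamE * 1 + 4 * m.lamE * (m.pE ^ 2)⁻¹ - 0 := by gcongr
    _ = _ := by ring

end Market.Regular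

/-- Markets in which `E` agents arrive faster than `H` agents and an `E` and an `H` agent may fail
to be compatible. -/
structure Market.Subcritical (m : Market) : Prop extends m.Regular where
  lamH_lt_lamE : m.lamH < m.lamE
  miss_pos : 0 < m.miss .E .H

/-- Fraction of the `E` agents that remain when every `H` agent is matched with an `E` agent. -/
def Market.excess (m : Market) : ℝ := 1 - m.lamH / m.lamE

/-- Limit of `pH * pE` times the number of waiting `H` agents as `pH` tends to zero. -/
def Market.load (m : Market) : ℝ := -Real.log m.excess

/-- Exponential rate at which `miss .E .H ^ h` decays in `h`. -/
def Market.decay (m : Market) : ℝ := -Real.log (m.miss .E .H)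

/-- Number of waiting `H` agents at which the rate of arrival of `H` agents equals the rate of
arrival of `E` agents compatible with one of them. -/
def Market.threshold (m : Market) : ℝ := m.load / m.decay

/-- The nonnegative quantity through which the generator controls the distance of the number `h`
of waiting `H` agents from the threshold. -/
def Market.deviation (m : Market) (h : ℕ) : ℝ :=
  (h - m.threshold) * (m.excess - m.miss .E .H ^ h)

/-- Bound for the mean of the deviation in steady state; it does not depend on `pH`. -/
def Market.spread (m : Market) : ℝ :=
  m.totalRate + 4 * m.lamH * (m.load / m.pE) ^ 2
    + m.lamH / m.lamE * (m.load / m.excess) * (m.totalRate + 4 * m.lamE * (m.pE ^ 2)⁻¹)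

namespace Market.Subcritical

variable (hm : m.Subcritical)
include hm

lemma excess_pos : 0 < m.excess := sub_pos.2 ((div_lt_one hm.lamE_pos).2 hm.lamH_lt_lamE)

lemma lamE_mul_excess : m.lamE * m.excess = m.lamE - m.lamH := by
  rw [Market.excess, mul_sub, mul_one, mul_div_cancel₀ _ hm.lamE_pos.ne']

lemma load_pos : 0 < m.load :=
  neg_pos.2 (Real.log_neg hm.excess_pos (sub_lt_self _ (div_pos hm.lamH_pos hm.lamE_pos)))

lemma spread_nonneg : 0 ≤ m.spread := by
  have hΛ := hm.totalRate_pos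
  have hlamH := hm.lamH_pos
  have hlamE := hm.lamE_pos
  have hload := hm.load_pos
  have hexcess := hm.excess_pos
  unfold spread
  positivity

lemma decay_pos : 0 < m.decay := neg_pos.2 (Real.log_neg hm.miss_pos (hm.miss_lt_one _ _))

lemma threshold_pos : 0 < m.threshold := div_pos hm.load_pos hm.decay_pos

lemma decay_mul_threshold : m.decay * m.threshold = m.load :=
  mul_div_cancel₀ _ hm.decay_pos.ne'

lemma exp_neg_load : Real.exp (-m.load) = m.excess := by
  rw [load, neg_neg, Real.exp_log hm.excess_pos]

lemma exp_neg_decay_mul (h : ℕ) : Real.exp (-(m.decay * h)) = m.miss .E .H ^ h := by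
  rw [decay, neg_mul, neg_neg, mul_comm, Real.exp_nat_mul, Real.exp_log hm.miss_pos]

lemma excess_le_miss_pow_iff {h : ℕ} : m.excess ≤ m.miss .E .H ^ h ↔ h ≤ m.threshold := by
  rw [← hm.exp_neg_load, ← hm.exp_neg_decay_mul, Real.exp_le_exp, neg_le_neg_iff, threshold,
    le_div_iff₀' hm.decay_pos]

lemma deviation_nonneg (h : ℕ) : 0 ≤ m.deviation h := by
  rcases le_total (h : ℝ) m.threshold with hle | hge
  · exact mul_nonneg_of_nonpos_of_nonpos (sub_nonpos.2 hle)
      (sub_nonpos.2 (hm.excess_le_miss_pow_iff.2 hle))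
  · refine mul_nonneg (sub_nonneg.2 hge) (sub_nonneg.2 ?_)
    rw [← hm.exp_neg_load, ← hm.exp_neg_decay_mul, Real.exp_le_exp, neg_le_neg_iff]
    exact (div_le_iff₀' hm.decay_pos).1 hge

lemma prob_mul_prob_le_decay : m.pE * m.pH ≤ m.decay := by
  have hlog := Real.log_le_sub_one_of_pos hm.miss_pos
  have hmiss : m.miss .E .H = 1 - m.pE * m.pH := rfl
  rw [decay]
  linarith

lemma threshold_mul_pH_le : m.threshold * m.pH ≤ m.load / m.pE := by
  rw [le_div_iff₀ hm.pE_pos, ← hm.decay_mul_threshold, mul_assoc, mul_comm m.pH,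
    mul_comm m.decay]
  exact mul_le_mul_of_nonneg_left hm.prob_mul_prob_le_decay hm.threshold_pos.le

/-- If `h` is below the threshold `c`, then `c * pH` is bounded and `miss .E .H ^ h` is bounded
below. -/
lemma threshold_sub_mul_le (h e : ℕ) :
    (m.threshold - h) * ((1 - m.miss .H .H ^ h * m.miss .H .E ^ e) + (1 - m.miss .H .H ^ h))
      ≤ 2 * (m.load / m.pE) ^ 2 + m.load / m.excess * (e * m.miss .E .H ^ h) := by
  have hv1 := (hm.miss_pow_mem_Icc .H .H h).2
  obtain ⟨hw0, hw1⟩ := hm.miss_pow_mem_Icc .H .E e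
  have hv : 1 - m.miss .H .H ^ h ≤ h * (m.pH * m.pH) := hm.one_sub_miss_pow_le .H .H h
  have hw : 1 - m.miss .H .E ^ e ≤ e * (m.pH * m.pE) := hm.one_sub_miss_pow_le .H .E e
  have hX := hm.load_pos
  have hρ := hm.excess_pos
  have hq := hm.pE_pos
  have hp : 0 < m.pH := hm.prob_pos .H
  have hc := hm.threshold_pos
  have hcp := hm.threshold_mul_pH_le
  have hstay : (1 - m.miss .H .H ^ h * m.miss .H .E ^ e) + (1 - m.miss .H .H ^ h)
      ≤ 2 * (1 - m.miss .H .H ^ h) + (1 - m.miss .H .E ^ e) := by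
    nlinarith [mul_nonneg (sub_nonneg.2 hv1) (sub_nonneg.2 hw1)]
  have hstay0 : 0 ≤ (1 - m.miss .H .H ^ h * m.miss .H .E ^ e) + (1 - m.miss .H .H ^ h) :=
    add_nonneg (sub_nonneg.2 (mul_le_one₀ hv1 hw0 hw1)) (sub_nonneg.2 hv1)
  rcases le_total (h : ℝ) m.threshold with hle | hge
  · have hu := hm.excess_le_miss_pow_iff.2 hle
    calc _ ≤ m.threshold * (2 * (m.threshold * (m.pH * m.pH)) + e * (m.pH * m.pE)) := by
          refine mul_le_mul (sub_le_self _ h.cast_nonneg) (hstay.trans ?_) hstay0 hc.le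
          have := mul_le_mul_of_nonneg_right hle (mul_nonneg hp.le hp.le)
          linarith
      _ = 2 * (m.threshold * m.pH) ^ 2 + e * (m.threshold * m.pH * m.pE) := by ring
      _ ≤ 2 * (m.load / m.pE) ^ 2 + e * (m.load / m.pE * m.pE) := by gcongr
      _ = 2 * (m.load / m.pE) ^ 2 + m.load / m.excess * (e * m.excess) := by field_simp
      _ ≤ _ := by gcongr
  · have hu := (hm.miss_pow_mem_Icc .E .H h).1
    exact (mul_nonpos_of_nonpos_of_nonneg (sub_nonpos.2 hge) hstay0).trans (by positivity)

lemma gen_sq_fst_add_le (s : State) :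
    m.gen .H (fun s => ((s.1 : ℝ) - m.threshold) ^ 2) s + 2 * m.lamE * m.deviation s.1
      ≤ m.totalRate + 4 * m.lamH * (m.load / m.pE) ^ 2
        + m.lamH / m.lamE * (m.load / m.excess) * (2 * m.lamE * (s.2 * m.miss .E .H ^ s.1)) := by
  have herror := mul_le_mul_of_nonneg_left (hm.threshold_sub_mul_le s.1 s.2)
    (mul_nonneg zero_le_two hm.lamH_pos.le)
  have hlamH := hm.lamH_pos.le
  have hlamE := hm.lamE_pos
  have hexcess := hm.lamE_mul_excess
  rw [gen_sq_fst, stayProb_eq, Market.totalRate, sum_agentType, sum_agentType, deviation]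
  simp only [Market.rate]
  obtain ⟨hu0, hu1⟩ := hm.miss_pow_mem_Icc .E .H s.1
  obtain ⟨hv0, hv1⟩ := hm.miss_pow_mem_Icc .H .H s.1
  obtain ⟨hw0, hw1⟩ := hm.miss_pow_mem_Icc .H .E s.2
  generalize m.miss .E .H ^ s.1 = u at *
  generalize m.miss .H .H ^ s.1 = v at *
  generalize m.miss .H .E ^ s.2 = w at *
  calc _ = m.lamH * (v * w + (1 - v)) + m.lamE * (1 - u)
        + 2 * m.lamH * ((m.threshold - s.1) * ((1 - v * w) + (1 - v))) := by
        linear_combination (2 * s.1 - 2 * m.threshold) * hexcess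
    _ ≤ m.lamH * 1 + m.lamE * 1 + 2 * m.lamH
        * (2 * (m.load / m.pE) ^ 2 + m.load / m.excess * (s.2 * u)) := by
        have hrate : v * w + (1 - v) ≤ 1 := by linarith [mul_le_of_le_one_right hv0 hw1]
        gcongr
        exact sub_le_self _ hu0
    _ = _ := by field_simp; ring

lemma mean_deviation_le {π : PMF State} (hπ : IsSteadyState m .H π) :
    mean π (fun s => .ofReal (2 * m.lamE * m.deviation s.1)) ≤ .ofReal m.spread := by
  have hΛ := hm.totalRate_pos.le
  have hlamH := hm.lamH_pos.le
  have hlamE := hm.lamE_pos.le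
  have hload := hm.load_pos.le
  have hexcess := hm.excess_pos.le
  have hmeanE := hm.mean_le_mean_of_gen_add_le hπ (fun s => sq_nonneg (s.2 : ℝ))
    (fun s => mul_nonneg (mul_nonneg zero_le_two hlamE)
      (mul_nonneg s.2.cast_nonneg (hm.miss_pow_mem_Icc .E .H s.1).1)) hm.gen_sq_snd_add_le
  rw [mean_const] at hmeanE
  have hmeanH := hm.mean_le_mean_of_gen_add_le hπ (fun s => sq_nonneg (s.1 - m.threshold))
    (fun s => mul_nonneg (mul_nonneg zero_le_two hlamE) (hm.deviation_nonneg s.1))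
    hm.gen_sq_fst_add_le
  exact hmeanH.trans (mean_ofReal_le_of_le_affine (by positivity) (by positivity) (by positivity)
    (fun _ => le_rfl) hmeanE)

lemma abs_decay_mul_meanH_sub_le {π : PMF State} (hπ : IsSteadyState m .H π) {δ M : ℝ}
    (hδ : 0 ≤ δ) (hM : 0 ≤ M)
    (hle : ∀ y, |y - m.load| ≤ δ + M * ((y - m.load) * (-Real.exp (-y) - -Real.exp (-m.load)))) :
    |m.decay * (meanH π).toReal - m.load| ≤ δ + M * m.decay / (2 * m.lamE) * m.spread := by
  have hdecay := hm.decay_pos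
  have hlamE := hm.lamE_pos
  have hspread := hm.spread_nonneg
  have hpointwise (s : State) : |m.decay * s.1 - m.load|
      ≤ δ + M * m.decay / (2 * m.lamE) * (2 * m.lamE * m.deviation s.1) := by
    refine (hle (m.decay * s.1)).trans_eq ?_
    rw [hm.exp_neg_load, hm.exp_neg_decay_mul, deviation, ← hm.decay_mul_threshold]
    field_simp
    ring
  have hmean := abs_toReal_mean_sub_le hm.load_pos.le (by positivity) <|
    mean_ofReal_le_of_le_affine hδ (by positivity) hspread hpointwise (hm.mean_deviation_le hπ)
  simpa only [meanH, ENNReal.ofReal_mul hdecay.le, mean_const_mul, ENNReal.toReal_mul,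
    ENNReal.toReal_ofReal hdecay.le, ENNReal.ofReal_natCast] using hmean

end Market.Subcritical

lemma regular_mk {lamH lamE pH pE : ℝ} (hlamH : 0 < lamH) (hlamE : 0 < lamE)
    (hpH : pH ∈ Ioc 0 1) (hpE : pE ∈ Ioc 0 1) : Market.Regular ⟨lamH, lamE, pH, pE⟩ where
  rate_pos := by rintro (_ | _); exacts [hlamH, hlamE]
  prob_pos := by rintro (_ | _); exacts [hpH.1, hpE.1]
  prob_le_one := by rintro (_ | _); exacts [hpH.2, hpE.2]

lemma subcritical_mk {lamH lamE pH pE : ℝ} (hlamH : lamH ∈ Ioo 0 lamE) (hpH : pH ∈ Ioo 0 1)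
    (hpE : pE ∈ Ioc 0 1) : Market.Subcritical ⟨lamH, lamE, pH, pE⟩ where
  toRegular := regular_mk hlamH.1 (hlamH.1.trans hlamH.2) (Ioo_subset_Ioc_self hpH) hpE
  lamH_lt_lamE := hlamH.2
  miss_pos := sub_pos.2 (mul_lt_one_of_nonneg_of_lt_one_right hpE.2 hpH.1.le hpH.2)

lemma hasDerivAt_neg_log_one_sub_mul (q : ℝ) :
    HasDerivAt (fun p => -Real.log (1 - q * p)) q 0 := by
  have hlinear : HasDerivAt (fun p : ℝ => 1 - q * p) (-q) 0 := by
    simpa using ((hasDerivAt_id (0 : ℝ)).const_mul q).const_sub 1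
  have hlog := (hlinear.log (by simp)).neg
  rwa [mul_zero, sub_zero, div_one, neg_neg] at hlog

lemma tendsto_div_neg_log_one_sub_mul {q : ℝ} (hq : q ≠ 0) :
    Tendsto (fun p => p / -Real.log (1 - q * p)) (𝓝[≠] 0) (𝓝 q⁻¹) := by
  refine ((hasDerivAt_neg_log_one_sub_mul q).tendsto_slope.inv₀ hq).congr fun p => ?_
  simp [slope_def_field]

lemma strictMonoOn_neg_log_one_sub_div :
    StrictMonoOn (fun x => -Real.log (1 - x) / x) (Ioo 0 1) := by
  intro x hx y hy hxy
  have hsecant := strictConcaveOn_log_Ioi.secant_strict_mono (a := 1) (x := 1 - y) (y := 1 - x)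
    (mem_Ioi.2 one_pos) (sub_pos.2 hy.2) (sub_pos.2 hx.2) (by linarith [hy.1]) (by linarith [hx.1])
    (by linarith)
  have hslope (t : ℝ) : (Real.log (1 - t) - Real.log 1) / (1 - t - 1) = -Real.log (1 - t) / t := by
    rw [Real.log_one, sub_zero, sub_sub_cancel_left, div_neg, neg_div]
  rwa [hslope, hslope] at hsecant

lemma strictMonoOn_neg_log_one_sub_div_div_mul {l q : ℝ} (hl : 0 < l) (hq : 0 < q) :
    StrictMonoOn (fun x => -Real.log (1 - x / l) / (q * x)) (Ioo 0 l) := by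
  have hscale (x : ℝ) :
      -Real.log (1 - x / l) / (q * x) = (q * l)⁻¹ * (-Real.log (1 - x / l) / (x / l)) := by
    field_simp
  have hmem {x : ℝ} (hx : x ∈ Ioo 0 l) : x / l ∈ Ioo 0 1 :=
    ⟨div_pos hx.1 hl, (div_lt_one hl).2 hx.2⟩
  intro x hx y hy hxy
  simp only [hscale]
  exact mul_lt_mul_of_pos_left (strictMonoOn_neg_log_one_sub_div (hmem hx) (hmem hy)
    (div_lt_div_of_pos_right hxy hl)) (inv_pos.2 (mul_pos hq hl))

section SmallCompatibility

variable {lamH lamE pE : ℝ} {π : ℝ → PMF State}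

lemma tendsto_neg_log_mul_meanH (hlamH : lamH ∈ Ioo 0 lamE) (hpE : pE ∈ Ioc 0 1)
    (hπ : ∀ᶠ pH in 𝓝[>] 0, IsSteadyState ⟨lamH, lamE, pH, pE⟩ .H (π pH)) :
    Tendsto (fun pH => -Real.log (1 - pE * pH) * (meanH (π pH)).toReal) (𝓝[>] 0)
      (𝓝 (-Real.log (1 - lamH / lamE))) := by
  rw [Metric.tendsto_nhds]
  intro ε hε
  have hmono : StrictMono fun y => -Real.exp (-y) :=
    fun _ _ hlt => neg_lt_neg (Real.exp_lt_exp.2 (neg_lt_neg hlt))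
  obtain ⟨M, hM, hle⟩ := exists_abs_sub_le_add_mul hmono (-Real.log (1 - lamH / lamE)) (half_pos hε)
  have hdecay : Tendsto (fun p => -Real.log (1 - pE * p)) (𝓝[>] 0) (𝓝 0) := by
    simpa using (hasDerivAt_neg_log_one_sub_mul pE).continuousAt.tendsto.mono_left
      nhdsWithin_le_nhds
  have herror : Tendsto (fun p => M * -Real.log (1 - pE * p) / (2 * lamE)
      * Market.spread ⟨lamH, lamE, 1, pE⟩) (𝓝[>] 0) (𝓝 0) := by
    simpa using ((hdecay.const_mul M).div_const (2 * lamE)).mul_const _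
  filter_upwards [hπ, Ioo_mem_nhdsGT one_pos, herror.eventually_lt_const (half_pos hε)]
    with pH hsteady hpH hsmall
  have hdist := (subcritical_mk hlamH hpH hpE).abs_decay_mul_meanH_sub_le hsteady
    (half_pos hε).le hM hle
  exact hdist.trans_lt ((add_lt_add_right hsmall _).trans_eq (add_halves ε))

theorem tendsto_mul_averageWaitH (hlamH : lamH ∈ Ioo 0 lamE) (hpE : pE ∈ Ioc 0 1)
    (hπ : ∀ᶠ pH in 𝓝[>] 0, IsSteadyState ⟨lamH, lamE, pH, pE⟩ .H (π pH)) :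
    Tendsto (fun pH => pH * (averageWaitH ⟨lamH, lamE, pH, pE⟩ .H (π pH)).toReal) (𝓝[>] 0)
      (𝓝 (-Real.log (1 - lamH / lamE) / (pE * lamH))) := by
  have hratio := (tendsto_div_neg_log_one_sub_mul hpE.1.ne').mono_left (nhdsGT_le_nhdsNE 0)
  have hlimit := (hratio.mul (tendsto_neg_log_mul_meanH hlamH hpE hπ)).div_const lamH
  rw [inv_mul_eq_div, div_div] at hlimit
  refine hlimit.congr' ?_
  filter_upwards [hπ, Ioo_mem_nhdsGT one_pos] with pH hsteady hpH
  have hm := subcritical_mk hlamH hpH hpE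
  have hdecay : -Real.log (1 - pE * pH) ≠ 0 := hm.decay_pos.ne'
  rw [hm.toReal_averageWaitH hsteady, ← mul_assoc, div_mul_cancel₀ _ hdecay, mul_div_assoc]
  rfl

end SmallCompatibility

end Asymptotics

end

end DynMarket

theorem mainTheorem8_general (lamE pE : ℝ) (hlamE : 0 < lamE) (hpE0 : 0 < pE) (hpE1 : pE ≤ 1) :
    (∀ lamH > 0, ∀ pH ∈ Ioc (0 : ℝ) 1,
      (∃! π : PMF DynMarket.State, DynMarket.IsSteadyState ⟨lamH, lamE, pH, pE⟩ .H π) ∧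
      ∀ π : PMF DynMarket.State, DynMarket.IsSteadyState ⟨lamH, lamE, pH, pE⟩ .H π →
        DynMarket.averageWaitH ⟨lamH, lamE, pH, pE⟩ .H π ≠ ⊤) ∧
    StrictMonoOn (fun lamH => -Real.log (1 - lamH / lamE) / (pE * lamH)) (Ioo 0 lamE) ∧
    ∀ lamH ∈ Ioo 0 lamE, ∀ π : ℝ → PMF DynMarket.State,
      (∀ᶠ pH in 𝓝[>] 0, DynMarket.IsSteadyState ⟨lamH, lamE, pH, pE⟩ .H (π pH)) →
        Tendsto
          (fun pH => pH * (DynMarket.averageWaitH ⟨lamH, lamE, pH, pE⟩ .H (π pH)).toReal)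
          (𝓝[>] 0) (𝓝 (-Real.log (1 - lamH / lamE) / (pE * lamH))) := by
  refine ⟨fun lamH hlamH pH hpH => ?_,
    DynMarket.strictMonoOn_neg_log_one_sub_div_div_mul hlamE hpE0,
    fun lamH hlamH π => DynMarket.tendsto_mul_averageWaitH hlamH ⟨hpE0, hpE1⟩⟩
  have hm := DynMarket.regular_mk hlamH hlamE hpH ⟨hpE0, hpE1⟩
  exact ⟨hm.existsUnique_steadyState .H, fun π => hm.averageWaitH_ne_top⟩

theorem mainTheorem8 (lamE pE : ℝ) (hlamE : 0 < lamE) (hpE0 : 0 < pE) (hpE1 : pE ≤ 1) :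
    (∀ lamH ∈ Ioo 0 lamE, ∀ pH ∈ Ioc (0 : ℝ) 1,
      ∃! π : PMF DynMarket.State, DynMarket.IsSteadyState ⟨lamH, lamE, pH, pE⟩ .H π) ∧
    ∃ L : ℝ → ℝ, StrictMonoOn L (Ioo 0 lamE) ∧
      ∀ lamH ∈ Ioo 0 lamE, ∀ π : ℝ → PMF DynMarket.State,
        (∀ pH ∈ Ioc (0 : ℝ) 1, DynMarket.IsSteadyState ⟨lamH, lamE, pH, pE⟩ .H (π pH)) →
          (∀ pH ∈ Ioc (0 : ℝ) 1,
            DynMarket.averageWaitH ⟨lamH, lamE, pH, pE⟩ .H (π pH) ≠ ⊤) ∧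
          Tendsto
            (fun pH : ℝ => pH * (DynMarket.averageWaitH ⟨lamH, lamE, pH, pE⟩ .H (π pH)).toReal)
            (𝓝[>] 0) (𝓝 (L lamH)) := by
  obtain ⟨hsteady, hmono, hlimit⟩ := mainTheorem8_general lamE pE hlamE hpE0 hpE1
  exact ⟨fun lamH hH pH hp => (hsteady lamH hH.1 pH hp).1, _, hmono, fun lamH hH π hπ =>
    ⟨fun pH hp => (hsteady lamH hH.1 pH hp).2 _ (hπ pH hp),
      hlimit lamH hH π (mem_of_superset (Ioc_mem_nhdsGT one_pos) hπ)⟩⟩
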